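/- **Setting.** Let $n,m,d\ge 1$. Agent $i\in\{1,\dots,n\}$ holds a local dataset $\mathcal M_i$ of $m$ samples, and each sample $z$ has a differentiable loss $\ell(\cdot;z):\mathbb R^d\to\mathbb R$. Put $f_i=\frac1m\sum_{z\in\mathcal M_i}\ell(\cdot;z)$, $f=\frac1n\sum_{i=1}^n f_i$ and, for $x=(x_1,\dots,x_n)\in(\mathbb R^d)^n$, $\nabla F(x)=(\nabla f_1(x_1),\dots,\nabla f_n(x_n))$. Assume that for some $L>0$ every sample loss satisfies $\|\nabla\ell(x;z)-\nabla\ell(x';z)\|_2\le L\|x-x'\|_2$ for all $x,x'\in\mathbb R^d$, and that $f^*=\inf_{x} f(x)>-\infty$. Let $W\in\mathbb R^{n\times n}$ be a mixing matrix of an undirected communication graph on the agents: $w_{ij}=0$ whenever $i\neq j$ are not adjacent, $W\mathbf 1_n=\mathbf 1_n$ and $W^\top\mathbf 1_n=\mathbf 1_n$. Let $\alpha=\|W-\frac1n\mathbf 1_n\mathbf 1_n^\top\|_{\mathrm{op}}$ be its mixing rate (spectral norm). **Algorithm (DESTRESS).** Let $T,S,b,K_{\mathrm{in}},K_{\mathrm{out}}\ge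 1$ be integers and $\eta>0$. Put $W_{\mathrm{in}}=W^{K_{\mathrm{in}}}$ and $W_{\mathrm{out}}=W^{K_{\mathrm{out}}}$. Start from a (possibly random) $\bar x^{(0)}\in\mathbb R^d$ with $\mathbb E|f(\bar x^{(0)})|<\infty$, and set $x_i^{(0)}=\bar x^{(0)}$ and $s_i^{(0)}=\nabla f(\bar x^{(0)})$ for all $i$; put $u^{(0),S}=x^{(0)}$. For $t=1,\dots,T$ set $$x^{(t)}=u^{(t-1),S},\qquad s^{(t)}=(W_{\mathrm{out}}\otimes I_d)\big(s^{(t-1)}+\nabla F(x^{(t)})-\nabla F(x^{(t-1)})\big),\qquad u^{(t),0}=x^{(t)},\qquad v^{(t),0}=s^{(t)},$$ and for $s=1,\dots,S$ every agent $i$ draws a mini-batch $\mathcal Z_i^{(t),s}$ of $b$ samples, independently and uniformly (with replacement) from $\mathcal M_i$, and one sets $$u^{(t),s}=(W_{\mathrm{in}}\otimes I_d)\big(u^{(t),s-1}-\eta v^{(t),s-1}\big),$$ $$g_i^{(t),s}=\frac1b\sum_{z\in\mathcal Z_i^{(t),s}}\big(\nabla\ell(u_i^{(t),s};z)-\nabla\ell(u_i^{(t),s-1};z)\big)+v_i^{(t),s-1},\qquad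 v^{(t),s}=(W_{\mathrm{in}}\otimes I_d)\,g^{(t),s}.$$ All draws are mutually independent and independent of $\bar x^{(0)}$. The output is $x^{\mathrm{output}}=u_i^{(t),s-1}$, where $(i,t,s)$ is uniform on $\{1,\dots,n\}\times\{1,\dots,T\}\times\{1,\dots,S\}$ and independent of everything else. **Theorem (first-order optimality).** Suppose that $$\eta\le\frac1L\min\Big\{\frac{(1-\alpha^{K_{\mathrm{in}}})(1-\alpha^{K_{\mathrm{out}}})}{10\big(1+\alpha^{K_{\mathrm{in}}}\alpha^{K_{\mathrm{out}}}\sqrt{nb}\big)\big(\sqrt{S/(nb)}+1\big)},\ \frac{(1-\alpha^{K_{\mathrm{in}}})^3}{10\,\alpha^{K_{\mathrm{in}}}},\ \frac{(1-\alpha^{K_{\mathrm{in}}})^{3/2}(1-\alpha^{K_{\mathrm{out}}})}{4\sqrt6\,\alpha^{K_{\mathrm{in}}}\alpha^{K_{\mathrm{out}}}}\Big\},$$ where a term with denominator $0$ (the last two if $\alpha=0$) is read as $+\infty$. Then $\mathbb E\|\nabla f(x^{\mathrm{output}})\|_2^2$ is finite and $$\mathbb E\big\|\nabla f(x^{\mathrm{output}})\big\|_2^2\le\frac{4}{\eta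 TS}\Big(\mathbb E[f(\bar x^{(0)})]-f^*\Big).$$ -/

import Mathlib

open MeasureTheory ProbabilityTheory
open scoped Matrix

noncomputable section

namespace Destress

/-- The parameter space `ℝ^d` with its Euclidean norm. -/
abbrev Param (d : ℕ) : Type := EuclideanSpace ℝ (Fin d)

/-- Stacked vectors in `ℝ^{nd}`: one vector of `ℝ^d` for each of the `n` agents. -/
abbrev Stack (n d : ℕ) : Type := Fin n → Param d

/-! ### Objective functions -/

/-- The local objective `f_i(x) = (1/m) ∑_{z ∈ M_i} ℓ(x; z)`. The `j`-th sample of the local dataset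
`M_i` of agent `i` is represented by its loss function `ℓ i j`. -/
def localObj {n m d : ℕ} (ℓ : Fin n → Fin m → Param d → ℝ) (i : Fin n) (x : Param d) : ℝ :=
  (1 / (m : ℝ)) * ∑ j, ℓ i j x

/-- The global objective `f(x) = (1/N) ∑_{z ∈ M} ℓ(x; z)`, `N = n m`, over the entire dataset. -/
def globalObj {n m d : ℕ} (ℓ : Fin n → Fin m → Param d → ℝ) (x : Param d) : ℝ :=
  (1 / ((n : ℝ) * (m : ℝ))) * ∑ i, ∑ j, ℓ i j x

/-- The distributed gradient `∇F(x) = [∇f_1(x_1), …, ∇f_n(x_n)]`. -/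
def distGrad {n m d : ℕ} (ℓ : Fin n → Fin m → Param d → ℝ) (x : Stack n d) : Stack n d :=
  fun i => gradient (localObj ℓ i) (x i)

/-- Every sample loss is differentiable with an `L`-Lipschitz gradient. -/
def LipschitzGradient {n m d : ℕ} (ℓ : Fin n → Fin m → Param d → ℝ) (L : ℝ) : Prop :=
  ∀ i j, Differentiable ℝ (ℓ i j) ∧
    ∀ x y : Param d, ‖gradient (ℓ i j) x - gradient (ℓ i j) y‖ ≤ L * ‖x - y‖

/-! ### Mixing -/

/-- `W` is a mixing matrix for the communication graph `G` : entries between distinct agents that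
are not joined by an edge vanish, and all row sums and column sums equal one. Entries may be
negative and `W` need not be symmetric. -/
structure IsMixingMatrix {n : ℕ} (G : SimpleGraph (Fin n)) (W : Matrix (Fin n) (Fin n) ℝ) :
    Prop where
  eq_zero_of_not_adj : ∀ i j, i ≠ j → ¬ G.Adj i j → W i j = 0
  mulVec_one : W *ᵥ 1 = 1
  transpose_mulVec_one : Wᵀ *ᵥ 1 = 1

/-- The mixing rate `α = ‖W - (1/n) 1 1ᵀ‖_op` (spectral norm). -/
def mixingRate {n : ℕ} (W : Matrix (Fin n) (Fin n) ℝ) : ℝ :=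
  ‖Matrix.toEuclideanCLM (n := Fin n) (𝕜 := ℝ) (W - Matrix.of fun _ _ => 1 / (n : ℝ))‖

/-- The action of `W ⊗ I_d` on a stacked vector. -/
def mix {n d : ℕ} (W : Matrix (Fin n) (Fin n) ℝ) (x : Stack n d) : Stack n d :=
  fun i => ∑ j, W i j • x j

/-! ### The algorithm -/

/-- One inner iteration `(u^{s-1}, v^{s-1}) ↦ (u^s, v^s)`, where agent `i` uses the mini-batch
`Z i : Fin b → Fin m` of positions in its local dataset. -/
def innerStep {n m d b : ℕ} (ℓ : Fin n → Fin m → Param d → ℝ) (W : Matrix (Fin n) (Fin n) ℝ)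
    (η : ℝ) (Kin : ℕ) (Z : Fin n → Fin b → Fin m) (p : Stack n d × Stack n d) :
    Stack n d × Stack n d :=
  let u : Stack n d := mix (W ^ Kin) (p.1 - η • p.2)
  let g : Stack n d := fun i =>
    (1 / (b : ℝ)) • ∑ k, (gradient (ℓ i (Z i k)) (u i) - gradient (ℓ i (Z i k)) (p.1 i)) + p.2 i
  (u, mix (W ^ Kin) g)

/-- The inner loop `(u^s, v^s)`, `s = 0, 1, 2, …`, started at `p = (u^0, v^0)`; the mini-batches of
iteration `s ≥ 1` are `Z s`. -/
def innerLoop {n m d b : ℕ} (ℓ : Fin n → Fin m → Param d → ℝ) (W : Matrix (Fin n) (Fin n) ℝ)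
    (η : ℝ) (Kin : ℕ) (Z : ℕ → Fin n → Fin b → Fin m) (p : Stack n d × Stack n d) :
    ℕ → Stack n d × Stack n d
  | 0 => p
  | s + 1 => innerStep ℓ W η Kin (Z (s + 1)) (innerLoop ℓ W η Kin Z p s)

/-- The outer loop `(x^t, s^t)`, `t = 0, 1, 2, …`, started from `x_i^0 = x₀`, `s_i^0 = ∇f(x₀)`. The
mini-batches of inner iteration `s ≥ 1` of outer iteration `t ≥ 1` are `Z t s`. No inner loop is
run at `t = 0`, so that `u^{0,S}` stands for `x^0`. -/
def outerLoop {n m d b : ℕ} (ℓ : Fin n → Fin m → Param d → ℝ) (W : Matrix (Fin n) (Fin n) ℝ)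
    (η : ℝ) (Kin Kout S : ℕ) (x₀ : Param d) (Z : ℕ → ℕ → Fin n → Fin b → Fin m) :
    ℕ → Stack n d × Stack n d
  | 0 => (fun _ => x₀, fun _ => gradient (globalObj ℓ) x₀)
  | t + 1 =>
    let p := outerLoop ℓ W η Kin Kout S x₀ Z t
    let x : Stack n d := if t = 0 then p.1 else (innerLoop ℓ W η Kin (Z t) p S).1
    (x, mix (W ^ Kout) (p.2 + distGrad ℓ x - distGrad ℓ p.1))

/-- The iterate `u_i^{t,s}` of the algorithm (for `t ≥ 1`). -/
def iterate {n m d b : ℕ} (ℓ : Fin n → Fin m → Param d → ℝ) (W : Matrix (Fin n) (Fin n) ℝ)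
    (η : ℝ) (Kin Kout S : ℕ) (x₀ : Param d) (Z : ℕ → ℕ → Fin n → Fin b → Fin m)
    (i : Fin n) (t s : ℕ) : Param d :=
  (innerLoop ℓ W η Kin (Z t) (outerLoop ℓ W η Kin Kout S x₀ Z t) s).1 i

/-- The output `u_i^{t,s-1}`, `t ∈ {1,…,T}`, `s ∈ {1,…,S}`, selected by the index `J = (i, t-1, s-1)`
in `{0,…,n-1} × {0,…,T-1} × {0,…,S-1}`. -/
def output {n m d b T S : ℕ} (ℓ : Fin n → Fin m → Param d → ℝ) (W : Matrix (Fin n) (Fin n) ℝ)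
    (η : ℝ) (Kin Kout : ℕ) (x₀ : Param d) (Z : ℕ → ℕ → Fin n → Fin b → Fin m)
    (J : Fin n × Fin T × Fin S) : Param d :=
  iterate ℓ W η Kin Kout S x₀ Z J.1 ((J.2.1 : ℕ) + 1) (J.2.2 : ℕ)

/-- The samples used by the algorithm, as one family indexed by
`(t-1, s-1, i, k) ∈ {0,…,T-1} × {0,…,S-1} × {0,…,n-1} × {0,…,b-1}`. -/
def usedSample {n m b : ℕ} (T S : ℕ) {Ω : Type*} (Z : ℕ → ℕ → Fin n → Fin b → Ω → Fin m)
    (q : Fin T × Fin S × Fin n × Fin b) (ω : Ω) : Fin m :=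
  Z ((q.1 : ℕ) + 1) ((q.2.1 : ℕ) + 1) q.2.2.1 q.2.2.2 ω

/-- The randomness of the algorithm: the (possibly random) initial parameter `x₀`, the samples
`Z t s i k` (the `k`-th element of the mini-batch of agent `i`), each uniform on the local dataset,
and the index `J` of the output, uniform on its range; the samples are mutually independent,
independent of `x₀`, and `J` is independent of `x₀` and the samples. -/
structure IsRandomness {n m d b T S : ℕ} {Ω : Type*} [MeasurableSpace Ω] (μ : Measure Ω)
    (x₀ : Ω → Param d) (Z : ℕ → ℕ → Fin n → Fin b → Ω → Fin m) (J : Ω → Fin n × Fin T × Fin S) :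
    Prop where
  measurable_init : Measurable x₀
  measurable_sample : ∀ q, Measurable (usedSample T S Z q)
  measurable_index : Measurable J
  sample_law : ∀ q, μ.map (usedSample T S Z q) = uniformOn Set.univ
  index_law : μ.map J = uniformOn Set.univ
  indep_sample : iIndepFun (usedSample T S Z) μ
  indep_init : IndepFun x₀ (fun ω q => usedSample T S Z q ω) μ
  indep_index : IndepFun J (fun ω => (x₀ ω, fun q => usedSample T S Z q ω)) μ

/-! ### The step size -/

/-- The bound of `η` by `1 / L` times the minimum of three terms. A term whose denominator is zero
(this happens for the last two if `α = 0`) is `+∞` and imposes no condition. -/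
structure StepSizeCondition (α L η : ℝ) (n b S Kin Kout : ℕ) : Prop where
  first : η ≤ (1 / L) * ((1 - α ^ Kin) * (1 - α ^ Kout) /
    (10 * (1 + α ^ Kin * α ^ Kout * √((n : ℝ) * b)) * (√((S : ℝ) / ((n : ℝ) * b)) + 1)))
  second : α ^ Kin ≠ 0 → η ≤ (1 / L) * ((1 - α ^ Kin) ^ 3 / (10 * α ^ Kin))
  third : α ^ Kin * α ^ Kout ≠ 0 →
    η ≤ (1 / L) * ((1 - α ^ Kin) ^ (3 / 2 : ℝ) * (1 - α ^ Kout) /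
      (4 * √6 * α ^ Kin * α ^ Kout))

end Destress

end

/-!
The expectation over the samples is a finite average, so the core of the argument treats a fixed
initial parameter `x₀` and sums over all families of samples (`sum_sum_gradient_sq_le`); the
theorem follows by integrating over the independent `x₀`. Working with one `x₀` at a time also gives
integrability at once: each of the finitely many terms is nonnegative and dominated by a multiple
of `f x₀ - inf f`.

For fixed samples the average `ū` of the iterates performs the exact step `ū ↦ ū - η v̄`, because
mixing preserves averages. The descent lemma yields (`gradient_sq_le_innerStep`)
`(1/n) ∑ ‖∇f(u_i)‖² ≤ (4/η) (f(ū) - f(ū')) - 2 (1 - η L) ‖v̄‖² + 4 e + (6 L²/n) P`, where `P` is the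
squared deviation of the iterates from consensus and `e` the squared error of `v̄` as an estimator
of the average of the local gradients. The differences of `f` telescope over inner and outer loops,
so `P` and `e` have to be absorbed by the negative term.

* `P` is controlled along every single trajectory. Mixing contracts deviations by `a = α ^ Kin` in
  the inner loop and by `c = α ^ Kout` in the tracking step, which gives linear recursions that
  couple the deviations of `u` and `v` with the step lengths. Their summed form is
  `sum_consensus_le`, and `error_le_descent` shows that the step size conditions make the feedback
  small.
* `e` is controlled on average. It vanishes at the beginning of an inner loop by gradient tracking,
  and every inner iteration adds independent centred noise, whose second moment is at most
  `L²/(n² b)` times the squared step length (`sum_norm_add_noise_sq_le`,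
  `sum_estimator_error_succ_le`). Independence enters through the fact that a state of the algorithm
  does not change if a later sample is redrawn (`state_update`).
-/

noncomputable section

namespace Destress

/-! ### Averages and deviations of stacked vectors -/

/-- The network average `(1/n) ∑ x_i` of a stacked vector. -/
def avg {n d : ℕ} (x : Stack n d) : Param d := (1 / (n : ℝ)) • ∑ i, x i

/-- The deviation from consensus, `x_i - avg x` at agent `i`. -/
def dev {n d : ℕ} (x : Stack n d) : Stack n d := fun i => x i - avg x

/-- The squared Euclidean norm on `ℝ^{nd}` (the norm of the function type `Stack n d` is a
supremum norm). -/
def sqNorm {n d : ℕ} (x : Stack n d) : ℝ := ∑ i, ‖x i‖ ^ 2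

section Stack

variable {n d : ℕ}

lemma sqNorm_nonneg (x : Stack n d) : 0 ≤ sqNorm x :=
  Finset.sum_nonneg fun _ _ => sq_nonneg _

lemma avg_add (x y : Stack n d) : avg (x + y) = avg x + avg y := by
  simp [avg, Finset.sum_add_distrib]

lemma avg_sub (x y : Stack n d) : avg (x - y) = avg x - avg y := by
  simp [avg, Finset.sum_sub_distrib, smul_sub]

lemma avg_smul (r : ℝ) (x : Stack n d) : avg (r • x) = r • avg x := by
  simp only [avg, Pi.smul_apply, ← Finset.smul_sum]
  rw [smul_comm]

lemma avg_const (hn : 0 < n) (y : Param d) : avg (fun _ : Fin n => y) = y := by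
  have h : (n : ℝ) ≠ 0 := by positivity
  simp only [avg, Finset.sum_const, Finset.card_univ, Fintype.card_fin]
  rw [← Nat.cast_smul_eq_nsmul ℝ, smul_smul, one_div, inv_mul_cancel₀ h, one_smul]

lemma sum_eq_smul_avg (hn : 0 < n) (x : Stack n d) : ∑ i, x i = (n : ℝ) • avg x := by
  have h : (n : ℝ) ≠ 0 := by positivity
  rw [avg, smul_smul, mul_one_div_cancel h, one_smul]

lemma dev_add (x y : Stack n d) : dev (x + y) = dev x + dev y := by
  ext1 i; simp only [dev, avg_add, Pi.add_apply]; abel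

lemma dev_sub (x y : Stack n d) : dev (x - y) = dev x - dev y := by
  ext1 i; simp only [dev, avg_sub, Pi.sub_apply]; abel

lemma dev_smul (r : ℝ) (x : Stack n d) : dev (r • x) = r • dev x := by
  ext1 i; simp only [dev, avg_smul, Pi.smul_apply, smul_sub]

lemma dev_const (hn : 0 < n) (y : Param d) : dev (fun _ : Fin n => y) = 0 := by
  ext1 i; simp [dev, avg_const hn]

lemma sqNorm_eq (hn : 0 < n) (x : Stack n d) :
    sqNorm x = n * ‖avg x‖ ^ 2 + sqNorm (dev x) := by
  have h : ∀ i, ‖x i‖ ^ 2 =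
      ‖avg x‖ ^ 2 + ‖dev x i‖ ^ 2 + 2 * inner ℝ (avg x) (x i - avg x) := fun i => by
    have := norm_add_sq_real (avg x) (dev x i)
    simp only [dev, add_sub_cancel] at this ⊢
    linarith
  have h0 : ∑ i, inner ℝ (avg x) (x i - avg x) = 0 := by
    rw [← inner_sum, Finset.sum_sub_distrib, sum_eq_smul_avg hn]
    simp [← Nat.cast_smul_eq_nsmul ℝ]
  simp only [sqNorm, h, Finset.sum_add_distrib, ← Finset.mul_sum, h0]
  simp

lemma sqNorm_dev_le (hn : 0 < n) (x : Stack n d) : sqNorm (dev x) ≤ sqNorm x := by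
  have := sqNorm_eq hn x
  have h : 0 ≤ (n : ℝ) * ‖avg x‖ ^ 2 := by positivity
  linarith

lemma norm_avg_sq_le (hn : 0 < n) (x : Stack n d) : ‖avg x‖ ^ 2 ≤ 1 / n * sqNorm x := by
  have h1 := sqNorm_eq hn x
  have h2 := sqNorm_nonneg (dev x)
  have h : (0 : ℝ) < n := by positivity
  rw [one_div, ← div_eq_inv_mul, le_div_iff₀ h]
  linarith

lemma sqNorm_smul (r : ℝ) (x : Stack n d) : sqNorm (r • x) = r ^ 2 * sqNorm x := by
  simp [sqNorm, norm_smul, mul_pow, Finset.mul_sum]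

lemma norm_sub_sq_le {E : Type*} [SeminormedAddCommGroup E] (x y : E) :
    ‖x - y‖ ^ 2 ≤ 2 * ‖x‖ ^ 2 + 2 * ‖y‖ ^ 2 := by
  have h := norm_sub_le x y
  have h0 := norm_nonneg (x - y)
  nlinarith [sq_nonneg (‖x‖ - ‖y‖)]

lemma norm_add_sq_le {E : Type*} [SeminormedAddCommGroup E] (x y : E) :
    ‖x + y‖ ^ 2 ≤ 2 * ‖x‖ ^ 2 + 2 * ‖y‖ ^ 2 := by
  simpa using norm_sub_sq_le x (-y)

lemma sqNorm_sub_le (x y : Stack n d) : sqNorm (x - y) ≤ 2 * sqNorm x + 2 * sqNorm y := by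
  simp only [sqNorm, Finset.mul_sum, ← Finset.sum_add_distrib]
  exact Finset.sum_le_sum fun i _ => norm_sub_sq_le (x i) (y i)

/-- Young's inequality in the form that turns a contraction by the factor `a` into a linear
recursion with the same factor; valid also for `a = 0`. -/
lemma sq_mul_sqNorm_add_le {a : ℝ} (h0 : 0 ≤ a) (h1 : a < 1) (x y : Stack n d) :
    a ^ 2 * sqNorm (x + y) ≤ a * sqNorm x + a ^ 2 / (1 - a) * sqNorm y := by
  simp only [sqNorm, Finset.mul_sum, ← Finset.sum_add_distrib]
  refine Finset.sum_le_sum fun i _ => ?_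
  have h2 : 0 < 1 - a := by linarith
  have h := norm_add_le (x i) (y i)
  have h' : ‖x i + y i‖ ^ 2 ≤ (‖x i‖ + ‖y i‖) ^ 2 := by gcongr
  have h3 : a * ‖x i‖ ^ 2 + a ^ 2 / (1 - a) * ‖y i‖ ^ 2 - a ^ 2 * (‖x i‖ + ‖y i‖) ^ 2 =
      a / (1 - a) * ((1 - a) * ‖x i‖ - a * ‖y i‖) ^ 2 := by
    field_simp; ring
  have h4 : 0 ≤ a / (1 - a) * ((1 - a) * ‖x i‖ - a * ‖y i‖) ^ 2 := by positivity
  have h5 : a ^ 2 * ‖x i + y i‖ ^ 2 ≤ a ^ 2 * (‖x i‖ + ‖y i‖) ^ 2 := by gcongr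
  simp only [Pi.add_apply]
  linarith

/-! ### Mixing contracts the deviation from consensus -/

lemma mix_one (x : Stack n d) : mix 1 x = x := by
  ext1 i; simp [mix, Matrix.one_apply]

lemma mix_mul (A B : Matrix (Fin n) (Fin n) ℝ) (x : Stack n d) :
    mix (A * B) x = mix A (mix B x) := by
  ext1 i
  simp only [mix, Matrix.mul_apply, Finset.sum_smul, Finset.smul_sum, smul_smul]
  exact Finset.sum_comm

lemma sqNorm_mix_le (M : Matrix (Fin n) (Fin n) ℝ) (x : Stack n d) :
    sqNorm (mix M x) ≤ ‖Matrix.toEuclideanCLM (n := Fin n) (𝕜 := ℝ) M‖ ^ 2 * sqNorm x := by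
  have hcomm : ∀ y : Stack n d, sqNorm y =
      ∑ k, ‖(WithLp.toLp 2 (fun i => y i k) : EuclideanSpace ℝ (Fin n))‖ ^ 2 := fun y => by
    simp only [sqNorm, EuclideanSpace.real_norm_sq_eq]
    exact Finset.sum_comm
  rw [hcomm, hcomm, Finset.mul_sum]
  refine Finset.sum_le_sum fun k _ => ?_
  have h : (WithLp.toLp 2 (fun i => mix M x i k) : EuclideanSpace ℝ (Fin n)) =
      Matrix.toEuclideanCLM (n := Fin n) (𝕜 := ℝ) M (WithLp.toLp 2 fun i => x i k) := by
    rw [Matrix.toEuclideanCLM_toLp]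
    congr 1
    ext i
    simp [mix, Matrix.mulVec, dotProduct]
  rw [h, ← mul_pow]
  gcongr
  exact ContinuousLinearMap.le_opNorm _ _

variable {G : SimpleGraph (Fin n)} {W : Matrix (Fin n) (Fin n) ℝ}

lemma IsMixingMatrix.row_sum (hW : IsMixingMatrix G W) (i : Fin n) : ∑ j, W i j = 1 := by
  simpa [Matrix.mulVec, dotProduct] using congrFun hW.mulVec_one i

lemma IsMixingMatrix.col_sum (hW : IsMixingMatrix G W) (j : Fin n) : ∑ i, W i j = 1 := by
  simpa [Matrix.mulVec, dotProduct] using congrFun hW.transpose_mulVec_one j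

lemma avg_mix (hW : IsMixingMatrix G W) (x : Stack n d) : avg (mix W x) = avg x := by
  simp only [avg, mix]
  rw [Finset.sum_comm]
  simp only [← Finset.sum_smul, hW.col_sum, one_smul]

lemma mix_const (hW : IsMixingMatrix G W) (y : Param d) :
    mix W (fun _ => y) = fun _ => y := by
  ext1 i
  simp only [mix, ← Finset.sum_smul, hW.row_sum, one_smul]

lemma dev_mix (hn : 0 < n) (hW : IsMixingMatrix G W) (x : Stack n d) :
    dev (mix W x) = mix (W - Matrix.of fun _ _ => 1 / (n : ℝ)) (dev x) := by
  have h0 : ∑ j, (x j - avg x) = 0 := by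
    rw [Finset.sum_sub_distrib, sum_eq_smul_avg hn]
    simp [← Nat.cast_smul_eq_nsmul ℝ]
  ext1 i
  calc dev (mix W x) i = ∑ j, W i j • (x j - avg x) := by
        simp only [dev, avg_mix hW, smul_sub, Finset.sum_sub_distrib, ← Finset.sum_smul,
          hW.row_sum, one_smul, mix]
    _ = ∑ j, W i j • (x j - avg x) - ∑ j, (1 / (n : ℝ)) • (x j - avg x) := by
        rw [← Finset.smul_sum, h0, smul_zero, sub_zero]
    _ = ∑ j, (W i j - 1 / (n : ℝ)) • (x j - avg x) := by
        rw [← Finset.sum_sub_distrib]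
        exact Finset.sum_congr rfl fun j _ => (sub_smul _ _ _).symm

lemma avg_mix_pow (hW : IsMixingMatrix G W) (K : ℕ) (x : Stack n d) :
    avg (mix (W ^ K) x) = avg x := by
  induction K with
  | zero => rw [pow_zero, mix_one]
  | succ K ih => rw [pow_succ', mix_mul, avg_mix hW, ih]

lemma mix_pow_const (hW : IsMixingMatrix G W) (K : ℕ) (y : Param d) :
    mix (W ^ K) (fun _ => y) = fun _ => y := by
  induction K with
  | zero => rw [pow_zero, mix_one]
  | succ K ih => rw [pow_succ', mix_mul, ih, mix_const hW]

lemma sqNorm_dev_mix_pow_le (hn : 0 < n) (hW : IsMixingMatrix G W) (K : ℕ) (x : Stack n d) :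
    sqNorm (dev (mix (W ^ K) x)) ≤ (mixingRate W ^ K) ^ 2 * sqNorm (dev x) := by
  induction K with
  | zero => simp [mix_one]
  | succ K ih =>
    rw [pow_succ', mix_mul, dev_mix hn hW]
    refine (sqNorm_mix_le _ _).trans ?_
    rw [pow_succ' (mixingRate W), mul_pow, mul_assoc]
    exact mul_le_mul_of_nonneg_left ih (sq_nonneg _)

lemma mixingRate_nonneg (W : Matrix (Fin n) (Fin n) ℝ) : 0 ≤ mixingRate W := norm_nonneg _

end Stack

/-! ### Smoothness of the objectives -/

/-- The descent lemma: a function whose gradient is `L`-Lipschitz lies below its quadratic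
upper model. -/
lemma le_of_lipschitz_gradient {E : Type*} [NormedAddCommGroup E] [InnerProductSpace ℝ E]
    [CompleteSpace E] {f : E → ℝ} {L : ℝ} (hf : Differentiable ℝ f)
    (hLip : ∀ x y, ‖gradient f x - gradient f y‖ ≤ L * ‖x - y‖) (x h : E) :
    f (x + h) ≤ f x + inner ℝ (gradient f x) h + L / 2 * ‖h‖ ^ 2 := by
  have hd : ∀ t : ℝ, HasDerivAt (fun t : ℝ => f (x + t • h))
      (inner ℝ (gradient f (x + t • h)) h) t := fun t => by
    have h1 : HasDerivAt (fun t : ℝ => x + t • h) h t := by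
      simpa using ((hasDerivAt_id t).smul_const h).const_add x
    have h2 := (hf (x + t • h)).hasFDerivAt.comp_hasDerivAt t h1
    rw [inner_gradient_left]
    exact h2
  have hB : ∀ t : ℝ, HasDerivAt
      (fun t : ℝ => f x + t * inner ℝ (gradient f x) h + L / 2 * ‖h‖ ^ 2 * t ^ 2)
      (inner ℝ (gradient f x) h + L * ‖h‖ ^ 2 * t) t := fun t => by
    have h1 := (((hasDerivAt_id t).mul_const (inner ℝ (gradient f x) h)).const_add (f x)).add
      ((hasDerivAt_pow 2 t).const_mul (L / 2 * ‖h‖ ^ 2))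
    exact h1.congr_deriv (by simp; ring)
  have key := image_le_of_deriv_right_le_deriv_boundary (a := 0) (b := 1)
    (fun t _ => (hd t).continuousAt.continuousWithinAt)
    (fun t _ => (hd t).hasDerivWithinAt) (by simp)
    (fun t _ => (hB t).continuousAt.continuousWithinAt)
    (fun t _ => (hB t).hasDerivWithinAt) (fun t ht => ?_)
    (Set.right_mem_Icc.2 zero_le_one)
  · simpa using key
  · have h1 : inner ℝ (gradient f (x + t • h) - gradient f x) h ≤ L * ‖t • h‖ * ‖h‖ := by
      refine (real_inner_le_norm _ _).trans ?_
      gcongr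
      simpa using hLip (x + t • h) x
    rw [inner_sub_left, norm_smul, Real.norm_of_nonneg ht.1] at h1
    nlinarith

section Smooth

variable {n m d : ℕ} {ℓ : Fin n → Fin m → Param d → ℝ} {L : ℝ}

lemma hasGradientAt_const_mul_sum {ι : Type*} [Fintype ι] {g : ι → Param d → ℝ}
    (hg : ∀ j, Differentiable ℝ (g j)) (r : ℝ) (x : Param d) :
    HasGradientAt (fun y => r * ∑ j, g j y) (r • ∑ j, gradient (g j) x) x := by
  rw [hasGradientAt_iff_hasFDerivAt]
  have h : HasFDerivAt (fun y => r * ∑ j, g j y) (r • ∑ j, fderiv ℝ (g j) x) x :=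
    (HasFDerivAt.fun_sum fun j _ => (hg j x).hasFDerivAt).const_mul r
  simpa [map_sum, toDual_gradient] using h

lemma LipschitzGradient.gradient_localObj (hLip : LipschitzGradient ℓ L) (i : Fin n)
    (x : Param d) :
    gradient (localObj ℓ i) x = (1 / (m : ℝ)) • ∑ j, gradient (ℓ i j) x :=
  (hasGradientAt_const_mul_sum (fun j => (hLip i j).1) _ x).gradient

lemma LipschitzGradient.differentiable_localObj (hLip : LipschitzGradient ℓ L) (i : Fin n) :
    Differentiable ℝ (localObj ℓ i) := fun x =>
  (hasGradientAt_const_mul_sum (fun j => (hLip i j).1) _ x).differentiableAt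

lemma globalObj_eq (ℓ : Fin n → Fin m → Param d → ℝ) :
    globalObj ℓ = fun x => (1 / (n : ℝ)) * ∑ i, localObj ℓ i x := by
  ext x
  simp only [globalObj, localObj, ← Finset.mul_sum, ← mul_assoc]
  congr 1
  rw [one_div_mul_one_div]

lemma LipschitzGradient.gradient_globalObj (hLip : LipschitzGradient ℓ L) (x : Param d) :
    gradient (globalObj ℓ) x = avg (distGrad ℓ fun _ => x) := by
  rw [globalObj_eq]
  exact (hasGradientAt_const_mul_sum hLip.differentiable_localObj _ x).gradient

lemma LipschitzGradient.differentiable_globalObj (hLip : LipschitzGradient ℓ L) :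
    Differentiable ℝ (globalObj ℓ) := fun x => by
  rw [globalObj_eq]
  exact (hasGradientAt_const_mul_sum hLip.differentiable_localObj _ x).differentiableAt

lemma norm_smul_sum_le {E : Type*} [SeminormedAddCommGroup E] [NormedSpace ℝ E] {k : ℕ}
    (hk : 0 < k) {C : ℝ} {y : Fin k → E} (hy : ∀ j, ‖y j‖ ≤ C) :
    ‖(1 / (k : ℝ)) • ∑ j, y j‖ ≤ C := by
  have h : (0 : ℝ) < k := by positivity
  rw [norm_smul, Real.norm_of_nonneg (by positivity), one_div, inv_mul_le_iff₀ h]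
  refine (norm_sum_le _ _).trans ((Finset.sum_le_sum fun j _ => hy j).trans ?_)
  simp

lemma LipschitzGradient.norm_localObj_sub_le (hLip : LipschitzGradient ℓ L) (hm : 0 < m)
    (i : Fin n) (x y : Param d) :
    ‖gradient (localObj ℓ i) x - gradient (localObj ℓ i) y‖ ≤ L * ‖x - y‖ := by
  rw [hLip.gradient_localObj, hLip.gradient_localObj, ← smul_sub, ← Finset.sum_sub_distrib]
  exact norm_smul_sum_le hm fun j => (hLip i j).2 x y

lemma LipschitzGradient.sqNorm_distGrad_sub_le (hLip : LipschitzGradient ℓ L) (hm : 0 < m)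
    (x y : Stack n d) :
    sqNorm (distGrad ℓ x - distGrad ℓ y) ≤ L ^ 2 * sqNorm (x - y) := by
  simp only [sqNorm, Finset.mul_sum, ← mul_pow]
  refine Finset.sum_le_sum fun i _ => ?_
  exact pow_le_pow_left₀ (norm_nonneg _) (hLip.norm_localObj_sub_le hm i (x i) (y i)) 2

lemma LipschitzGradient.norm_globalObj_sub_le (hLip : LipschitzGradient ℓ L) (hn : 0 < n)
    (hm : 0 < m) (x y : Param d) :
    ‖gradient (globalObj ℓ) x - gradient (globalObj ℓ) y‖ ≤ L * ‖x - y‖ := by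
  rw [hLip.gradient_globalObj, hLip.gradient_globalObj, ← avg_sub]
  exact norm_smul_sum_le hn fun i => hLip.norm_localObj_sub_le hm i x y

lemma LipschitzGradient.continuous_gradient (hLip : LipschitzGradient ℓ L)
    (i : Fin n) (j : Fin m) : Continuous (gradient (ℓ i j)) :=
  (LipschitzWith.of_dist_le' fun x y => by
    simpa only [dist_eq_norm] using (hLip i j).2 x y).continuous

lemma LipschitzGradient.continuous_gradient_localObj (hLip : LipschitzGradient ℓ L)
    (hm : 0 < m) (i : Fin n) : Continuous (gradient (localObj ℓ i)) :=
  (LipschitzWith.of_dist_le' fun x y => by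
    simpa only [dist_eq_norm] using hLip.norm_localObj_sub_le hm i x y).continuous

lemma LipschitzGradient.continuous_gradient_globalObj (hLip : LipschitzGradient ℓ L)
    (hn : 0 < n) (hm : 0 < m) : Continuous (gradient (globalObj ℓ)) :=
  (LipschitzWith.of_dist_le' fun x y => by
    simpa only [dist_eq_norm] using hLip.norm_globalObj_sub_le hn hm x y).continuous

end Smooth

end Destress

end

namespace Destress

/-! ### The coupled recursions of consensus and tracking errors -/

/-- Solution of the coupled linear recursions, summed over all iterations: `P` and `Q` are the
squared consensus errors of the iterates and of the gradient estimators, `δ` the squared length of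
an inner step, `D` that of an outer step and `w` the share of an inner step that moves the average.
The sum of `P` over the successors of all iterates is bounded in terms of itself and of the sum of
`w`. -/
lemma sum_consensus_le {a c A B C : ℝ} {S : ℕ} (ha0 : 0 ≤ a) (ha1 : a < 1) (hc1 : c < 1)
    (hA : 0 ≤ A) (hB : 0 ≤ B) (hC : 0 ≤ C) (hS : 0 < S) {P Q w δ : ℕ → ℕ → ℝ} {D : ℕ → ℝ}
    (hP : ∀ t s, 0 ≤ P t s) (hQ : ∀ t s, 0 ≤ Q t s)
    (hP1 : ∀ t s, P t (s + 1) ≤ a * P t s + A * Q t s)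
    (hQ1 : ∀ t s, Q t (s + 1) ≤ a * Q t s + B * δ t s)
    (hδ : ∀ t s, δ t s ≤ w t s + 2 * P t (s + 1) + 2 * P t s)
    (hP00 : P 0 0 = 0) (hP0 : ∀ t, P (t + 1) 0 = P t S)
    (hQ00 : Q 0 0 = 0) (hQ0 : ∀ t, Q (t + 1) 0 ≤ c * Q t 0 + C * D t)
    (hD : ∀ t, D t ≤ S * ∑ s ∈ Finset.range S, w t s + 2 * P (t + 1) 0 + 2 * P t 0) (T : ℕ) :
    ∃ X : ℝ, 0 ≤ X ∧ (∑ t ∈ Finset.range T, ∑ s ∈ Finset.range S, P t s) ≤ X ∧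
      (∑ t ∈ Finset.range T, ∑ s ∈ Finset.range S, δ t s) ≤
        (∑ t ∈ Finset.range T, ∑ s ∈ Finset.range S, w t s) + 4 * X ∧
      X ≤ A / (1 - a) * ((C / (1 - c) *
          (S * (∑ t ∈ Finset.range T, ∑ s ∈ Finset.range S, w t s) + 4 * X)) / (1 - a) +
        B / (1 - a) * ((∑ t ∈ Finset.range T, ∑ s ∈ Finset.range S, w t s) + 4 * X)) := by
  set V := ∑ t ∈ Finset.range T, ∑ s ∈ Finset.range S, w t s with hV
  set P0 := ∑ t ∈ Finset.range T, ∑ s ∈ Finset.range S, P t s with hP0_def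
  set X := ∑ t ∈ Finset.range T, ∑ s ∈ Finset.range S, P t (s + 1) with hX
  set Q0 := ∑ t ∈ Finset.range T, ∑ s ∈ Finset.range S, Q t s with hQ0_def
  set Q1 := ∑ t ∈ Finset.range T, ∑ s ∈ Finset.range S, Q t (s + 1) with hQ1_def
  set R := ∑ t ∈ Finset.range T, Q t 0 with hR
  set Δ := ∑ t ∈ Finset.range T, ∑ s ∈ Finset.range S, δ t s with hΔ
  have ha : 0 < 1 - a := by linarith
  have hc : 0 < 1 - c := by linarith
  have hPX : P0 ≤ X := by
    have h1 : ∀ t, ∑ s ∈ Finset.range S, P t (s + 1) - ∑ s ∈ Finset.range S, P t s =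
        P (t + 1) 0 - P t 0 := fun t => by
      rw [hP0, ← Finset.sum_sub_distrib, Finset.sum_range_sub]
    have h2 : X - P0 = P T 0 - P 0 0 := by
      rw [hX, hP0_def, ← Finset.sum_sub_distrib, Finset.sum_congr rfl fun t _ => h1 t,
        Finset.sum_range_sub (fun t => P t 0)]
    linarith [hP T 0]
  have hXle : X ≤ a * P0 + A * Q0 := by
    simp only [hX, hP0_def, hQ0_def, Finset.mul_sum, ← Finset.sum_add_distrib]
    exact Finset.sum_le_sum fun t _ => Finset.sum_le_sum fun s _ => hP1 t s
  have hX0 : 0 ≤ X := Finset.sum_nonneg fun t _ => Finset.sum_nonneg fun s _ => hP t _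
  have hΔle : Δ ≤ V + 2 * X + 2 * P0 := by
    simp only [hΔ, hV, hX, hP0_def, Finset.mul_sum, ← Finset.sum_add_distrib]
    exact Finset.sum_le_sum fun t _ => Finset.sum_le_sum fun s _ => hδ t s
  have hQ1le : Q1 ≤ a * Q0 + B * Δ := by
    simp only [hQ1_def, hΔ, hQ0_def, Finset.mul_sum, ← Finset.sum_add_distrib]
    exact Finset.sum_le_sum fun t _ => Finset.sum_le_sum fun s _ => hQ1 t s
  have hQ0le : Q0 ≤ Q1 + R := by
    simp only [hQ1_def, hR, hQ0_def, ← Finset.sum_add_distrib]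
    refine Finset.sum_le_sum fun t _ => ?_
    have h := Finset.sum_range_sub (fun s => Q t s) S
    rw [Finset.sum_sub_distrib] at h
    linarith [hQ t S]
  have hDle : ∑ t ∈ Finset.range T, D t ≤ S * V + 4 * X := by
    have h1 : ∑ t ∈ Finset.range T, P (t + 1) 0 ≤ X := by
      refine Finset.sum_le_sum fun t _ => ?_
      obtain ⟨S', rfl⟩ : ∃ S', S = S' + 1 := ⟨S - 1, by omega⟩
      rw [hP0]
      exact Finset.single_le_sum (f := fun s => P t (s + 1)) (fun s _ => hP t _)
        (Finset.self_mem_range_succ S')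
    have h2 : ∑ t ∈ Finset.range T, P t 0 ≤ P0 :=
      Finset.sum_le_sum fun t _ =>
        Finset.single_le_sum (f := fun s => P t s) (fun s _ => hP t _) (Finset.mem_range.2 hS)
    have h3 : ∑ t ∈ Finset.range T, D t ≤ S * V + 2 * ∑ t ∈ Finset.range T, P (t + 1) 0 +
        2 * ∑ t ∈ Finset.range T, P t 0 := by
      simp only [hV, Finset.mul_sum, ← Finset.sum_add_distrib]
      refine Finset.sum_le_sum fun t _ => ?_
      simpa only [Finset.mul_sum] using hD t
    linarith
  have hRle : R ≤ c * R + C * ∑ t ∈ Finset.range T, D t := by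
    have h1 : ∑ t ∈ Finset.range T, Q (t + 1) 0 ≤ c * R + C * ∑ t ∈ Finset.range T, D t := by
      simp only [hR, Finset.mul_sum, ← Finset.sum_add_distrib]
      exact Finset.sum_le_sum fun t _ => hQ0 t
    have h2 := Finset.sum_range_sub (fun t => Q t 0) T
    rw [Finset.sum_sub_distrib] at h2
    linarith [hQ T 0]
  have hR' : R ≤ C / (1 - c) * (S * V + 4 * X) := by
    rw [div_mul_eq_mul_div, le_div_iff₀ hc]
    linarith [mul_le_mul_of_nonneg_left hDle hC]
  have hΔ' : Δ ≤ V + 4 * X := by linarith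
  have hQ' : Q0 ≤ (C / (1 - c) * (S * V + 4 * X)) / (1 - a) + B / (1 - a) * (V + 4 * X) := by
    rw [div_mul_eq_mul_div B, ← add_div, le_div_iff₀ ha]
    linarith [mul_le_mul_of_nonneg_left hΔ' hB]
  refine ⟨X, hX0, hPX, hΔ', ?_⟩
  have hX' : X ≤ A / (1 - a) * Q0 := by
    rw [div_mul_eq_mul_div, le_div_iff₀ ha]
    linarith [mul_le_mul_of_nonneg_left hPX ha0]
  exact hX'.trans (mul_le_mul_of_nonneg_left hQ' (by positivity))

/-- The step size conditions make the errors caused by disagreement of the agents and by sampling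
smaller than the decrease of the objective. Here `N` stands for `n * b`, `θ` for `η * L`, and `X`
is the sum of consensus errors bounded in `sum_consensus_le`. -/
lemma error_le_descent {a c θ N S V X P Δ : ℝ} (ha0 : 0 ≤ a) (ha1 : a < 1) (hc1 : c < 1)
    (hθ : 0 ≤ θ) (hV : 0 ≤ V) (hX : 0 ≤ X) (hN : 0 < N) (hS : 0 ≤ S)
    (h1 : θ ≤ (1 - a) / 10) (h2 : θ ^ 2 * S / N ≤ (1 - a) ^ 2 / 100)
    (h3 : θ ^ 2 * a ^ 2 * c ^ 2 * S ≤ (1 - a) ^ 2 * (1 - c) ^ 2 / 100)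
    (h4 : θ * a ≤ (1 - a) ^ 3 / 10)
    (h5 : 96 * (θ ^ 2 * a ^ 2 * c ^ 2) ≤ (1 - a) ^ 3 * (1 - c) ^ 2)
    (hP : P ≤ X) (hΔ : Δ ≤ V + 4 * X)
    (hXle : X ≤ θ ^ 2 * a ^ 2 / (1 - a) ^ 2 * (c ^ 2 / (1 - c) ^ 2 * (S * V + 4 * X) / (1 - a) +
      a ^ 2 / (1 - a) ^ 2 * (V + 4 * X))) :
    6 * θ ^ 2 * P + 4 * (θ ^ 2 * S / N) * Δ ≤ 2 * (1 - θ) * V := by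
  have ha : 0 < 1 - a := by linarith
  have hc : 0 < 1 - c := by linarith
  set k₁ := θ ^ 2 * a ^ 2 * c ^ 2 / ((1 - a) ^ 3 * (1 - c) ^ 2) with hk₁
  set k₂ := θ ^ 2 * a ^ 4 / (1 - a) ^ 4 with hk₂
  set ρ := θ ^ 2 * S / N with hρ
  have hρ0 : 0 ≤ ρ := by positivity
  have e1 : k₁ ≤ 1 / 96 := by
    rw [hk₁, div_le_iff₀ (by positivity)]; linarith
  have e2 : (1 - a) * (k₁ * S) ≤ 1 / 100 := by
    have : (1 - a) * (k₁ * S) = θ ^ 2 * a ^ 2 * c ^ 2 * S / ((1 - a) ^ 2 * (1 - c) ^ 2) := by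
      rw [hk₁]; field_simp
    rw [this, div_le_iff₀ (by positivity)]; linarith
  have e3 : k₂ ≤ 1 / 100 := by
    rw [hk₂, div_le_iff₀ (by positivity)]
    have s1 : (θ * a) ^ 2 ≤ ((1 - a) ^ 3 / 10) ^ 2 := by gcongr
    have s2 : a ^ 2 * (1 - a) ^ 2 ≤ 1 := by
      rw [← mul_pow]; exact pow_le_one₀ (by positivity) (by nlinarith)
    calc θ ^ 2 * a ^ 4 = (θ * a) ^ 2 * a ^ 2 := by ring
      _ ≤ ((1 - a) ^ 3 / 10) ^ 2 * a ^ 2 := by gcongr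
      _ = (1 - a) ^ 4 / 100 * (a ^ 2 * (1 - a) ^ 2) := by ring
      _ ≤ (1 - a) ^ 4 / 100 * 1 := by gcongr
      _ = 1 / 100 * (1 - a) ^ 4 := by ring
  have e4 : X ≤ 11 / 10 * ((k₁ * S + k₂) * V) := by
    have : θ ^ 2 * a ^ 2 / (1 - a) ^ 2 * (c ^ 2 / (1 - c) ^ 2 * (S * V + 4 * X) / (1 - a) +
        a ^ 2 / (1 - a) ^ 2 * (V + 4 * X)) = (k₁ * S + k₂) * V + 4 * (k₁ + k₂) * X := by
      rw [hk₁, hk₂]; field_simp; ring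
    rw [this] at hXle
    have : (k₁ + k₂) * X ≤ (1 / 96 + 1 / 100) * X := by gcongr
    have h0 : 0 ≤ (k₁ * S + k₂) * V := by positivity
    linarith
  -- Both weights of `X` carry the factor `(1 - a) ^ 2`, which pays for the bound of `k₁ * S`.
  have e5 : ∀ r, 0 ≤ r → r ≤ (1 - a) ^ 2 / 100 → r * X ≤ 3 / 10000 * V := fun r hr0 hr => by
    have s1 : (1 - a) ^ 2 * (k₁ * S) ≤ 1 / 100 := by
      have : (1 - a) * ((1 - a) * (k₁ * S)) ≤ 1 * (1 / 100) := by
        gcongr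
        linarith
      linarith
    have s2 : (1 - a) ^ 2 * k₂ ≤ 1 * (1 / 100) := by
      gcongr
      exact pow_le_one₀ ha.le (by linarith)
    have s3 : r * (k₁ * S + k₂) ≤ 2 / 10000 := by
      have : r * (k₁ * S + k₂) ≤ (1 - a) ^ 2 / 100 * (k₁ * S + k₂) := by gcongr
      linarith
    calc r * X ≤ r * (11 / 10 * ((k₁ * S + k₂) * V)) := by gcongr
      _ = 11 / 10 * (r * (k₁ * S + k₂)) * V := by ring
      _ ≤ 11 / 10 * (2 / 10000) * V := by gcongr
      _ ≤ 3 / 10000 * V := by gcongr; norm_num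
  have f1 : θ ^ 2 * X ≤ 3 / 10000 * V := by
    refine e5 _ (sq_nonneg _) ?_
    calc θ ^ 2 ≤ ((1 - a) / 10) ^ 2 := by gcongr
      _ = (1 - a) ^ 2 / 100 := by ring
  have f2 := e5 ρ hρ0 h2
  have f3 : ρ * V ≤ 1 / 100 * V := by
    gcongr
    have : (1 - a) ^ 2 ≤ 1 := pow_le_one₀ ha.le (by linarith)
    linarith
  have f4 : θ * V ≤ 1 / 10 * V := by gcongr; linarith
  have f5 : θ ^ 2 * P ≤ θ ^ 2 * X := by gcongr
  have f6 : ρ * Δ ≤ ρ * (V + 4 * X) := by gcongr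
  linarith

/-- The consequences of the step size condition in the form used by `error_le_descent`, with
`a = α ^ Kin` and `c = α ^ Kout`. The second bound excludes `α ≥ 1`. -/
lemma StepSizeCondition.bounds {α L η : ℝ} {n b S Kin Kout : ℕ} (hα : 0 ≤ α) (hL : 0 < L)
    (hη : 0 < η) (hn : 0 < n) (hb : 0 < b) (hKin : 0 < Kin) (hKout : 0 < Kout)
    (h : StepSizeCondition α L η n b S Kin Kout) :
    α ^ Kin < 1 ∧ α ^ Kout < 1 ∧ η * L ≤ (1 - α ^ Kin) / 10 ∧
    (η * L) ^ 2 * S / ((n : ℝ) * b) ≤ (1 - α ^ Kin) ^ 2 / 100 ∧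
    (η * L) ^ 2 * (α ^ Kin) ^ 2 * (α ^ Kout) ^ 2 * S ≤
      (1 - α ^ Kin) ^ 2 * (1 - α ^ Kout) ^ 2 / 100 ∧
    η * L * α ^ Kin ≤ (1 - α ^ Kin) ^ 3 / 10 ∧
    96 * ((η * L) ^ 2 * (α ^ Kin) ^ 2 * (α ^ Kout) ^ 2) ≤
      (1 - α ^ Kin) ^ 3 * (1 - α ^ Kout) ^ 2 := by
  have hN : 0 < (n : ℝ) * b := by positivity
  have hθ : 0 < η * L := by positivity
  have scale : ∀ y, η ≤ 1 / L * y → η * L ≤ y := fun y hy => by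
    rwa [one_div, ← div_eq_inv_mul, le_div_iff₀ hL] at hy
  have hα1 : α < 1 := by
    by_contra hge
    have ha : 1 ≤ α ^ Kin := one_le_pow₀ (not_lt.1 hge)
    have h2 := scale _ (h.second (by positivity))
    have : (1 - α ^ Kin) ^ 3 / (10 * α ^ Kin) ≤ 0 :=
      div_nonpos_of_nonpos_of_nonneg (Odd.pow_nonpos (by decide) (by linarith)) (by positivity)
    linarith
  have ha1 : α ^ Kin < 1 := pow_lt_one₀ hα hα1 hKin.ne'
  have hc1 : α ^ Kout < 1 := pow_lt_one₀ hα hα1 hKout.ne'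
  have ha0 : 0 ≤ α ^ Kin := by positivity
  have hc0 : 0 ≤ α ^ Kout := by positivity
  have h1 := scale _ h.first
  have h2 := fun h0 => scale _ (h.second h0)
  have h3 := fun h0 => scale _ (h.third h0)
  generalize α ^ Kin = a at *
  generalize α ^ Kout = c at *
  generalize η * L = θ at *
  have ha : 0 < 1 - a := by linarith
  have hc : 0 < 1 - c := by linarith
  have hr := Real.sqrt_nonneg ((n : ℝ) * b)
  have hq := Real.sqrt_nonneg ((S : ℝ) / ((n : ℝ) * b))
  rw [le_div_iff₀ (by positivity)] at h1
  have hacr : 0 ≤ a * c * √((n : ℝ) * b) := by positivity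
  have hprod : (1 - a) * (1 - c) ≤ 1 - a := by nlinarith
  have g1 : θ * √((S : ℝ) / ((n : ℝ) * b)) ≤ (1 - a) / 10 := by
    have : 0 ≤ θ * (a * c * √((n : ℝ) * b)) * (√((S : ℝ) / ((n : ℝ) * b)) + 1) := by positivity
    nlinarith
  have g2 : θ * (a * c * (√((n : ℝ) * b) * √((S : ℝ) / ((n : ℝ) * b)))) ≤
      (1 - a) * (1 - c) / 10 := by
    have : 0 ≤ θ * √((S : ℝ) / ((n : ℝ) * b)) := by positivity
    have : 0 ≤ θ * (a * c * √((n : ℝ) * b)) := by positivity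
    nlinarith
  refine ⟨ha1, hc1, ?_, ?_, ?_, ?_, ?_⟩
  · have : 0 ≤ θ * √((S : ℝ) / ((n : ℝ) * b)) := by positivity
    have : 0 ≤ θ * (a * c * √((n : ℝ) * b)) * (√((S : ℝ) / ((n : ℝ) * b)) + 1) := by positivity
    nlinarith
  · calc θ ^ 2 * S / ((n : ℝ) * b) = (θ * √((S : ℝ) / ((n : ℝ) * b))) ^ 2 := by
          rw [mul_pow, Real.sq_sqrt (by positivity), mul_div_assoc]
      _ ≤ ((1 - a) / 10) ^ 2 := by gcongr
      _ = (1 - a) ^ 2 / 100 := by ring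
  · rw [← Real.sqrt_mul hN.le, mul_div_cancel₀ _ hN.ne'] at g2
    calc θ ^ 2 * a ^ 2 * c ^ 2 * S = (θ * (a * c * √(S : ℝ))) ^ 2 := by
          rw [mul_pow, mul_pow, Real.sq_sqrt (by positivity)]; ring
      _ ≤ ((1 - a) * (1 - c) / 10) ^ 2 := by gcongr
      _ = (1 - a) ^ 2 * (1 - c) ^ 2 / 100 := by ring
  · rcases eq_or_ne a 0 with rfl | h0
    · norm_num
    · have := h2 h0
      have ha' : 0 < a := lt_of_le_of_ne ha0 h0.symm
      rw [le_div_iff₀ (by positivity)] at this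
      linarith
  · rcases eq_or_ne (a * c) 0 with h0 | h0
    · have : θ ^ 2 * a ^ 2 * c ^ 2 = θ ^ 2 * (a * c) ^ 2 := by ring
      rw [this, h0]
      simp only [ne_eq, OfNat.ofNat_ne_zero, not_false_eq_true, zero_pow, mul_zero]
      positivity
    · have h3 := h3 h0
      have ha' : 0 < a := lt_of_le_of_ne ha0 (left_ne_zero_of_mul h0).symm
      have hc' : 0 < c := lt_of_le_of_ne hc0 (right_ne_zero_of_mul h0).symm
      have hr : ((1 - a) ^ (3 / 2 : ℝ)) ^ 2 = (1 - a) ^ 3 := by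
        rw [← Real.rpow_natCast, ← Real.rpow_mul ha.le, ← Real.rpow_natCast]
        norm_num
      rw [le_div_iff₀ (by positivity)] at h3
      have h4 : (θ * (4 * √6 * a * c)) ^ 2 ≤ ((1 - a) ^ (3 / 2 : ℝ) * (1 - c)) ^ 2 := by
        gcongr
      rw [mul_pow ((1 - a) ^ (3 / 2 : ℝ)), hr] at h4
      have h6 : (√6) ^ 2 = (6 : ℝ) := Real.sq_sqrt (by norm_num)
      calc 96 * (θ ^ 2 * a ^ 2 * c ^ 2) = 16 * (√6) ^ 2 * (θ ^ 2 * a ^ 2 * c ^ 2) := by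
            rw [h6]; ring
        _ = (θ * (4 * √6 * a * c)) ^ 2 := by ring
        _ ≤ _ := h4

end Destress

namespace Destress

/-! ### Averaging over independent uniform samples -/

section Sampling

variable {ι κ : Type*} [Fintype ι] [DecidableEq ι] [Fintype κ]

/-- Resampling one coordinate does not change an average over all families of samples. -/
lemma sum_sum_update (φ : (ι → κ) → ℝ) (q : ι) :
    ∑ ω : ι → κ, ∑ z : κ, φ (Function.update ω q z) = Fintype.card κ * ∑ ω, φ ω := by
  have hinv : Function.Involutive
      (fun p : (ι → κ) × κ => (Function.update p.1 q p.2, p.1 q)) := fun p => by simp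
  have h := Equiv.sum_comp hinv.toPerm (fun p : (ι → κ) × κ => φ p.1)
  rw [Fintype.sum_prod_type, Fintype.sum_prod_type] at h
  simpa [Finset.mul_sum] using h

variable {E : Type*} [NormedAddCommGroup E] [InnerProductSpace ℝ E]

/-- The average of `‖A + (y - mean)‖²` is at most `‖A‖²` plus the second moment of `y`. -/
lemma sum_norm_add_sub_mean_sq_le [Nonempty κ] (A : E) (y : κ → E) :
    ∑ z, ‖A + (y z - (1 / (Fintype.card κ : ℝ)) • ∑ j, y j)‖ ^ 2 ≤
      Fintype.card κ * ‖A‖ ^ 2 + ∑ z, ‖y z‖ ^ 2 := by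
  have hk : (0 : ℝ) < Fintype.card κ := by exact_mod_cast Fintype.card_pos
  set k : ℝ := (Fintype.card κ : ℝ) with hk_def
  set M : E := (1 / k) • ∑ j, y j with hM
  have hsum : ∑ j, y j = k • M := by rw [hM, smul_smul, mul_one_div_cancel hk.ne', one_smul]
  have h : ∀ z, ‖A + (y z - M)‖ ^ 2 = ‖A - M‖ ^ 2 + 2 * inner ℝ (A - M) (y z) + ‖y z‖ ^ 2 :=
    fun z => by rw [← norm_add_sq_real, sub_add_eq_add_sub, add_sub_assoc]
  simp only [h, Finset.sum_add_distrib, ← Finset.mul_sum, ← inner_sum, hsum, Finset.sum_const,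
    Finset.card_univ, nsmul_eq_mul, ← hk_def]
  rw [inner_smul_right, inner_sub_left, norm_sub_sq_real, real_inner_self_eq_norm_sq]
  nlinarith [mul_nonneg hk.le (sq_nonneg ‖M‖)]

/-- Independent centred noise terms add at most their second moments to the mean square of a
vector that is determined by other samples. The noise terms use the samples `ω (e p)`, and the
base point `A` and the distribution `Y` of the noise do not depend on these. -/
lemma sum_norm_add_noise_sq_le [Nonempty κ] {ι' : Type*} {e : ι' → ι}
    (he : Function.Injective e) (A : (ι → κ) → E) (Y : ι' → (ι → κ) → κ → E)
    (hA : ∀ ω p z, A (Function.update ω (e p) z) = A ω)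
    (hY : ∀ r ω p z, Y r (Function.update ω (e p) z) = Y r ω) (s : Finset ι') :
    ∑ ω : ι → κ, ‖A ω + ∑ p ∈ s, (Y p ω (ω (e p)) -
        (1 / (Fintype.card κ : ℝ)) • ∑ j, Y p ω j)‖ ^ 2 ≤
      ∑ ω : ι → κ, (‖A ω‖ ^ 2 + ∑ p ∈ s, 1 / (Fintype.card κ : ℝ) * ∑ j, ‖Y p ω j‖ ^ 2) := by
  classical
  have hk : (0 : ℝ) < Fintype.card κ := by exact_mod_cast Fintype.card_pos
  induction s using Finset.induction_on with
  | empty => simp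
  | insert p s hp ih =>
    set B : (ι → κ) → E := fun ω => A ω + ∑ p ∈ s, (Y p ω (ω (e p)) -
      (1 / (Fintype.card κ : ℝ)) • ∑ j, Y p ω j) with hB
    have hBp : ∀ ω z, B (Function.update ω (e p) z) = B ω := fun ω z => by
      simp only [hB, hA, hY]
      congr 1
      refine Finset.sum_congr rfl fun r hr => ?_
      rw [Function.update_of_ne (he.ne (ne_of_mem_of_not_mem hr hp))]
    have h1 : ∀ ω : ι → κ, A ω + ∑ p ∈ insert p s, (Y p ω (ω (e p)) -
        (1 / (Fintype.card κ : ℝ)) • ∑ j, Y p ω j) =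
        B ω + (Y p ω (ω (e p)) - (1 / (Fintype.card κ : ℝ)) • ∑ j, Y p ω j) := fun ω => by
      rw [Finset.sum_insert hp, hB]; dsimp only; abel
    simp only [h1]
    simp only [Finset.sum_insert hp]
    have h2 := sum_sum_update (fun ω : ι → κ => ‖B ω + (Y p ω (ω (e p)) -
      (1 / (Fintype.card κ : ℝ)) • ∑ j, Y p ω j)‖ ^ 2) (e p)
    simp only [hBp, hY, Function.update_self] at h2
    have h3 := Finset.sum_le_sum fun (ω : ι → κ) (_ : ω ∈ Finset.univ) =>
      sum_norm_add_sub_mean_sq_le (B ω) (Y p ω)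
    rw [h2, Finset.sum_add_distrib, ← Finset.mul_sum] at h3
    have h4 : ∑ ω : ι → κ, ‖B ω + (Y p ω (ω (e p)) -
        (1 / (Fintype.card κ : ℝ)) • ∑ j, Y p ω j)‖ ^ 2 ≤
        ∑ ω, ‖B ω‖ ^ 2 + 1 / (Fintype.card κ : ℝ) * ∑ ω, ∑ j, ‖Y p ω j‖ ^ 2 := by
      refine ((le_div_iff₀' hk).2 h3).trans (le_of_eq ?_)
      field_simp
    refine h4.trans ?_
    rw [Finset.mul_sum]
    simp only [Finset.sum_add_distrib] at ih ⊢
    linarith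

end Sampling

end Destress

noncomputable section

namespace Destress

/-! ### One inner iteration -/

section InnerStep

variable {n m d b Kin : ℕ} {ℓ : Fin n → Fin m → Param d → ℝ} {L η : ℝ}
  {G : SimpleGraph (Fin n)} {W : Matrix (Fin n) (Fin n) ℝ}

/-- The iterate is moved without using the new mini-batch. -/
lemma innerStep_fst (Z : Fin n → Fin b → Fin m) (p : Stack n d × Stack n d) :
    (innerStep ℓ W η Kin Z p).1 = mix (W ^ Kin) (p.1 - η • p.2) := rfl

lemma avg_innerStep_fst (hW : IsMixingMatrix G W) (Z : Fin n → Fin b → Fin m)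
    (p : Stack n d × Stack n d) :
    avg (innerStep ℓ W η Kin Z p).1 = avg p.1 - η • avg p.2 := by
  rw [innerStep_fst, avg_mix_pow hW, avg_sub, avg_smul]

lemma sqNorm_dev_mix_pow_add_le (hn : 0 < n) (hW : IsMixingMatrix G W) {K : ℕ}
    (ha1 : mixingRate W ^ K < 1) (x y : Stack n d) :
    sqNorm (dev (mix (W ^ K) (x + y))) ≤ mixingRate W ^ K * sqNorm (dev x) +
      (mixingRate W ^ K) ^ 2 / (1 - mixingRate W ^ K) * sqNorm (dev y) := by
  refine (sqNorm_dev_mix_pow_le hn hW K _).trans ?_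
  rw [dev_add]
  exact sq_mul_sqNorm_add_le (pow_nonneg (mixingRate_nonneg W) K) ha1 _ _

lemma sqNorm_dev_innerStep_fst_le (hn : 0 < n) (hW : IsMixingMatrix G W)
    (ha1 : mixingRate W ^ Kin < 1) (Z : Fin n → Fin b → Fin m) (p : Stack n d × Stack n d) :
    sqNorm (dev (innerStep ℓ W η Kin Z p).1) ≤ mixingRate W ^ Kin * sqNorm (dev p.1) +
      (mixingRate W ^ Kin) ^ 2 / (1 - mixingRate W ^ Kin) * η ^ 2 * sqNorm (dev p.2) := by
  have h := sqNorm_dev_mix_pow_add_le hn hW ha1 p.1 ((-η) • p.2)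
  rw [dev_smul, sqNorm_smul, neg_smul, ← sub_eq_add_neg, neg_sq, ← mul_assoc] at h
  exact h

lemma sqNorm_dev_innerStep_snd_le (hn : 0 < n) (hb : 0 < b) (hLip : LipschitzGradient ℓ L)
    (hW : IsMixingMatrix G W)
    (ha1 : mixingRate W ^ Kin < 1) (Z : Fin n → Fin b → Fin m) (p : Stack n d × Stack n d) :
    sqNorm (dev (innerStep ℓ W η Kin Z p).2) ≤ mixingRate W ^ Kin * sqNorm (dev p.2) +
      (mixingRate W ^ Kin) ^ 2 / (1 - mixingRate W ^ Kin) * L ^ 2 *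
        sqNorm ((innerStep ℓ W η Kin Z p).1 - p.1) := by
  set u := (innerStep ℓ W η Kin Z p).1 with hu
  set y : Stack n d := fun i =>
    (1 / (b : ℝ)) • ∑ k, (gradient (ℓ i (Z i k)) (u i) - gradient (ℓ i (Z i k)) (p.1 i)) with hy
  have h : (innerStep ℓ W η Kin Z p).2 = mix (W ^ Kin) (p.2 + y) := by
    rw [add_comm]; rfl
  have hy_le : sqNorm (dev y) ≤ L ^ 2 * sqNorm (u - p.1) := by
    refine (sqNorm_dev_le hn y).trans ?_
    simp only [sqNorm, Finset.mul_sum, ← mul_pow]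
    refine Finset.sum_le_sum fun i _ => pow_le_pow_left₀ (norm_nonneg _) ?_ 2
    exact norm_smul_sum_le hb fun k => (hLip i (Z i k)).2 (u i) (p.1 i)
  rw [h]
  refine (sqNorm_dev_mix_pow_add_le hn hW ha1 p.2 y).trans ?_
  have h1 : 0 < 1 - mixingRate W ^ Kin := by linarith
  rw [mul_assoc]
  gcongr

lemma sqNorm_innerStep_sub_le (hn : 0 < n) (hW : IsMixingMatrix G W)
    (Z : Fin n → Fin b → Fin m) (p : Stack n d × Stack n d) :
    sqNorm ((innerStep ℓ W η Kin Z p).1 - p.1) ≤ n * η ^ 2 * ‖avg p.2‖ ^ 2 +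
      2 * sqNorm (dev (innerStep ℓ W η Kin Z p).1) + 2 * sqNorm (dev p.1) := by
  rw [sqNorm_eq hn, avg_sub, avg_innerStep_fst hW, dev_sub, sub_sub_cancel_left, norm_neg,
    norm_smul, mul_pow, Real.norm_eq_abs, sq_abs, add_assoc, mul_assoc]
  gcongr
  exact sqNorm_sub_le _ _

/-- The contribution to the averaged gradient estimator of one sample `j`, drawn by agent `q.1` as
the `q.2`-th element of its mini-batch. -/
def sampleIncrement (b : ℕ) (ℓ : Fin n → Fin m → Param d → ℝ) (W : Matrix (Fin n) (Fin n) ℝ)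
    (η : ℝ) (Kin : ℕ) (p : Stack n d × Stack n d) (q : Fin n × Fin b) (j : Fin m) : Param d :=
  (1 / (n : ℝ)) • (1 / (b : ℝ)) • (gradient (ℓ q.1 j) (mix (W ^ Kin) (p.1 - η • p.2) q.1) -
    gradient (ℓ q.1 j) (p.1 q.1))

/-- The error of the averaged gradient estimator changes by centred noise terms, one for each
sample of the mini-batches. -/
lemma avg_innerStep_snd_sub (hb : 0 < b) (hLip : LipschitzGradient ℓ L)
    (hW : IsMixingMatrix G W) (Z : Fin n → Fin b → Fin m) (p : Stack n d × Stack n d) :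
    avg (innerStep ℓ W η Kin Z p).2 - avg (distGrad ℓ (innerStep ℓ W η Kin Z p).1) =
      (avg p.2 - avg (distGrad ℓ p.1)) + ∑ q : Fin n × Fin b,
        (sampleIncrement b ℓ W η Kin p q (Z q.1 q.2) -
          (1 / (Fintype.card (Fin m) : ℝ)) • ∑ j, sampleIncrement b ℓ W η Kin p q j) := by
  set u := (innerStep ℓ W η Kin Z p).1 with hu
  set y : Stack n d := fun i =>
    (1 / (b : ℝ)) • ∑ k, (gradient (ℓ i (Z i k)) (u i) - gradient (ℓ i (Z i k)) (p.1 i)) with hy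
  have h : (innerStep ℓ W η Kin Z p).2 = mix (W ^ Kin) (y + p.2) := rfl
  have hb' : (b : ℝ) ≠ 0 := by positivity
  have h1 : ∑ q : Fin n × Fin b, sampleIncrement b ℓ W η Kin p q (Z q.1 q.2) = avg y := by
    simp only [sampleIncrement, Fintype.sum_prod_type, ← Finset.smul_sum, avg, hy]
    rfl
  have h2 : ∀ q : Fin n × Fin b,
      (1 / (Fintype.card (Fin m) : ℝ)) • ∑ j, sampleIncrement b ℓ W η Kin p q j =
      (1 / (n : ℝ)) • (1 / (b : ℝ)) • (distGrad ℓ u - distGrad ℓ p.1) q.1 := fun q => by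
    simp only [sampleIncrement, ← Finset.smul_sum, Fintype.card_fin, Pi.sub_apply, distGrad,
      hLip.gradient_localObj, ← smul_sub, ← Finset.sum_sub_distrib]
    rw [smul_comm (1 / (m : ℝ)) (1 / (n : ℝ)), smul_comm (1 / (m : ℝ)) (1 / (b : ℝ))]
    rfl
  have h3 : ∑ q : Fin n × Fin b,
      (1 / (n : ℝ)) • (1 / (b : ℝ)) • (distGrad ℓ u - distGrad ℓ p.1) q.1 =
      avg (distGrad ℓ u - distGrad ℓ p.1) := by
    simp only [Fintype.sum_prod_type, ← Finset.smul_sum, avg, Finset.sum_const, Finset.card_univ,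
      Fintype.card_fin]
    rw [← Nat.cast_smul_eq_nsmul ℝ, smul_smul _ (b : ℝ), one_div_mul_cancel hb', one_smul]
  rw [Finset.sum_sub_distrib, h1, Finset.sum_congr rfl fun q _ => h2 q, h3, h, avg_mix_pow hW,
    avg_add, avg_sub]
  abel

lemma sum_sampleIncrement_le (hn : 0 < n) (hm : 0 < m) (hb : 0 < b)
    (hLip : LipschitzGradient ℓ L) (p : Stack n d × Stack n d) :
    ∑ q : Fin n × Fin b, 1 / (Fintype.card (Fin m) : ℝ) *
        ∑ j, ‖sampleIncrement b ℓ W η Kin p q j‖ ^ 2 ≤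
      L ^ 2 / (n ^ 2 * b) * sqNorm (mix (W ^ Kin) (p.1 - η • p.2) - p.1) := by
  have hn' : (0 : ℝ) < n := by positivity
  have hm' : (0 : ℝ) < m := by positivity
  have hb' : (0 : ℝ) < b := by positivity
  set u := mix (W ^ Kin) (p.1 - η • p.2) with hu
  have h1 : ∀ q : Fin n × Fin b, 1 / (Fintype.card (Fin m) : ℝ) *
      ∑ j, ‖sampleIncrement b ℓ W η Kin p q j‖ ^ 2 ≤
      (1 / n * (1 / b) * (L * ‖(u - p.1) q.1‖)) ^ 2 := fun q => by
    rw [one_div, ← div_eq_inv_mul, Fintype.card_fin, div_le_iff₀ hm']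
    refine (Finset.sum_le_sum fun j _ => pow_le_pow_left₀ (norm_nonneg _) (?_ :
      _ ≤ 1 / n * (1 / b) * (L * ‖(u - p.1) q.1‖)) 2).trans ?_
    · rw [sampleIncrement, norm_smul, norm_smul, Real.norm_of_nonneg (by positivity),
        Real.norm_of_nonneg (by positivity), ← mul_assoc]
      gcongr
      exact (hLip q.1 j).2 _ _
    · simp [mul_comm]
  refine (Finset.sum_le_sum fun q _ => h1 q).trans (le_of_eq ?_)
  simp only [Fintype.sum_prod_type, Finset.sum_const, Finset.card_univ, Fintype.card_fin,
    nsmul_eq_mul, sqNorm, Finset.mul_sum]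
  refine Finset.sum_congr rfl fun i _ => ?_
  field_simp

/-- One step decreases the objective at the average. The factor `2` in
`‖∇f(u_i)‖² ≤ 2 ‖∇f(avg u)‖² + 2 L² ‖u_i - avg u‖²` is the reason for the constant `4 / η`. -/
lemma gradient_sq_le_innerStep (hn : 0 < n) (hm : 0 < m) (hη : 0 < η)
    (hLip : LipschitzGradient ℓ L) (hW : IsMixingMatrix G W) (Z : Fin n → Fin b → Fin m)
    (p : Stack n d × Stack n d) :
    1 / (n : ℝ) * ∑ i, ‖gradient (globalObj ℓ) (p.1 i)‖ ^ 2 ≤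
      4 / η * (globalObj ℓ (avg p.1) - globalObj ℓ (avg (innerStep ℓ W η Kin Z p).1)) -
      2 * (1 - η * L) * ‖avg p.2‖ ^ 2 + 4 * ‖avg p.2 - avg (distGrad ℓ p.1)‖ ^ 2 +
      6 * L ^ 2 / n * sqNorm (dev p.1) := by
  have hn' : (0 : ℝ) < n := by positivity
  rw [avg_innerStep_fst hW]
  set x := avg p.1 with hx
  set v := avg p.2 with hv
  set g := gradient (globalObj ℓ) x with hg
  set h := avg (distGrad ℓ p.1) with hh
  set P := sqNorm (dev p.1) with hP
  have h1 : 1 / (n : ℝ) * ∑ i, ‖gradient (globalObj ℓ) (p.1 i)‖ ^ 2 ≤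
      2 * ‖g‖ ^ 2 + 2 * L ^ 2 / n * P := by
    have : ∀ i, ‖gradient (globalObj ℓ) (p.1 i)‖ ^ 2 ≤
        2 * ‖g‖ ^ 2 + 2 * L ^ 2 * ‖dev p.1 i‖ ^ 2 := fun i => by
      have e1 := norm_add_sq_le g (gradient (globalObj ℓ) (p.1 i) - g)
      rw [add_sub_cancel] at e1
      have e2 := pow_le_pow_left₀ (norm_nonneg _) (hLip.norm_globalObj_sub_le hn hm (p.1 i) x) 2
      rw [mul_pow] at e2
      change _ ≤ 2 * ‖g‖ ^ 2 + 2 * L ^ 2 * ‖p.1 i - x‖ ^ 2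
      linarith
    rw [one_div, ← div_eq_inv_mul, div_le_iff₀ hn']
    refine (Finset.sum_le_sum fun i _ => this i).trans (le_of_eq ?_)
    simp only [Finset.sum_add_distrib, ← Finset.mul_sum, hP, sqNorm, Finset.sum_const,
      Finset.card_univ, Fintype.card_fin, nsmul_eq_mul]
    field_simp
  have h2 := le_of_lipschitz_gradient hLip.differentiable_globalObj
    (hLip.norm_globalObj_sub_le hn hm) x (-(η • v))
  rw [← sub_eq_add_neg, inner_neg_right, norm_neg, norm_smul, inner_smul_right, mul_pow,
    Real.norm_eq_abs, sq_abs, ← hg] at h2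
  have h3 : ‖g - v‖ ^ 2 = ‖g‖ ^ 2 - 2 * inner ℝ g v + ‖v‖ ^ 2 := norm_sub_sq_real g v
  have h4 : ‖g - v‖ ^ 2 ≤ 2 * ‖g - h‖ ^ 2 + 2 * ‖v - h‖ ^ 2 := by
    simpa using norm_sub_sq_le (g - h) (v - h)
  have h5 : ‖g - h‖ ^ 2 ≤ L ^ 2 / n * P := by
    rw [hg, hLip.gradient_globalObj, hh, ← avg_sub]
    refine (norm_avg_sq_le hn _).trans ?_
    have e1 := hLip.sqNorm_distGrad_sub_le hm (fun _ => x) p.1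
    have e2 : sqNorm ((fun _ => x) - p.1) = P := by
      simp only [hP, sqNorm, Pi.sub_apply, dev, hx]
      exact Finset.sum_congr rfl fun i _ => by rw [norm_sub_rev]
    rw [e2] at e1
    calc 1 / (n : ℝ) * _ ≤ 1 / n * (L ^ 2 * P) := by gcongr
      _ = L ^ 2 / n * P := by ring
  have h6 : 2 * ‖g‖ ^ 2 ≤ 4 / η * (globalObj ℓ x - globalObj ℓ (x - η • v)) -
      2 * (1 - η * L) * ‖v‖ ^ 2 + 2 * ‖g - v‖ ^ 2 := by
    have e : 4 / η * (η * inner ℝ g v - L / 2 * (η ^ 2 * ‖v‖ ^ 2)) =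
        4 * inner ℝ g v - 2 * (η * L) * ‖v‖ ^ 2 := by field_simp; ring
    have e' : 4 / η * (η * inner ℝ g v - L / 2 * (η ^ 2 * ‖v‖ ^ 2)) ≤
        4 / η * (globalObj ℓ x - globalObj ℓ (x - η • v)) :=
      mul_le_mul_of_nonneg_left (by linarith) (by positivity)
    linarith
  have h7 : 6 * L ^ 2 / n * P = 2 * L ^ 2 / n * P + 4 * (L ^ 2 / n * P) := by ring
  linarith

end InnerStep

end Destress

end

noncomputable section

namespace Destress

/-! ### The trajectory of the algorithm -/

/-- The pair `(u^{t+1,s}, v^{t+1,s})`: outer iterations are counted from `0`. -/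
def state {n m d b : ℕ} (ℓ : Fin n → Fin m → Param d → ℝ) (W : Matrix (Fin n) (Fin n) ℝ)
    (η : ℝ) (Kin Kout S : ℕ) (x₀ : Param d) (Z : ℕ → ℕ → Fin n → Fin b → Fin m) (t s : ℕ) :
    Stack n d × Stack n d :=
  innerLoop ℓ W η Kin (Z (t + 1)) (outerLoop ℓ W η Kin Kout S x₀ Z (t + 1)) s

/-- A family of samples of the algorithm, as a function of all positive times; it takes a default
value at times beyond the horizon, and truncated subtraction makes the irrelevant times `0` share
the samples of times `1`. -/
def extendSample {n m b T S : ℕ} (hm : 0 < m) (ω : Fin T × Fin S × Fin n × Fin b → Fin m) :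
    ℕ → ℕ → Fin n → Fin b → Fin m := fun t s i k =>
  if h : t - 1 < T ∧ s - 1 < S then ω (⟨t - 1, h.1⟩, ⟨s - 1, h.2⟩, i, k) else ⟨0, hm⟩

section Trajectory

variable {n m d b Kin Kout S : ℕ} {ℓ : Fin n → Fin m → Param d → ℝ} {L η : ℝ}
  {G : SimpleGraph (Fin n)} {W : Matrix (Fin n) (Fin n) ℝ} {x₀ : Param d}

lemma state_succ (Z : ℕ → ℕ → Fin n → Fin b → Fin m) (t s : ℕ) :
    state ℓ W η Kin Kout S x₀ Z t (s + 1) =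
      innerStep ℓ W η Kin (Z (t + 1) (s + 1)) (state ℓ W η Kin Kout S x₀ Z t s) := rfl

lemma state_succ_zero (Z : ℕ → ℕ → Fin n → Fin b → Fin m) (t : ℕ) :
    state ℓ W η Kin Kout S x₀ Z (t + 1) 0 =
      ((state ℓ W η Kin Kout S x₀ Z t S).1,
        mix (W ^ Kout) ((state ℓ W η Kin Kout S x₀ Z t 0).2 +
          distGrad ℓ (state ℓ W η Kin Kout S x₀ Z t S).1 -
          distGrad ℓ (state ℓ W η Kin Kout S x₀ Z t 0).1)) := rfl

lemma state_zero_zero (hW : IsMixingMatrix G W) (Z : ℕ → ℕ → Fin n → Fin b → Fin m) :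
    state ℓ W η Kin Kout S x₀ Z 0 0 =
      (fun _ => x₀, fun _ => gradient (globalObj ℓ) x₀) := by
  have h : state ℓ W η Kin Kout S x₀ Z 0 0 = ((fun _ => x₀ : Stack n d),
      mix (W ^ Kout) ((fun _ => gradient (globalObj ℓ) x₀) + distGrad ℓ (fun _ => x₀) -
        distGrad ℓ fun _ => x₀)) := rfl
  rw [h, add_sub_cancel_right, mix_pow_const hW]

/-- A state depends only on the samples drawn before it. -/
lemma state_congr (hW : IsMixingMatrix G W) {Z Z' : ℕ → ℕ → Fin n → Fin b → Fin m} {t s : ℕ}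
    (h : ∀ t' < t, ∀ s' < S, Z (t' + 1) (s' + 1) = Z' (t' + 1) (s' + 1))
    (h' : ∀ s' < s, Z (t + 1) (s' + 1) = Z' (t + 1) (s' + 1)) :
    state ℓ W η Kin Kout S x₀ Z t s = state ℓ W η Kin Kout S x₀ Z' t s := by
  induction t generalizing s with
  | zero =>
    induction s with
    | zero => rw [state_zero_zero hW, state_zero_zero hW]
    | succ s ih =>
      rw [state_succ, state_succ, ih fun s' hs' => h' s' (hs'.trans (Nat.lt_succ_self s)),
        h' s (Nat.lt_succ_self s)]
  | succ t iht =>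
    have hlt : ∀ t' < t, ∀ s' < S, Z (t' + 1) (s' + 1) = Z' (t' + 1) (s' + 1) :=
      fun t' ht' => h t' (ht'.trans (Nat.lt_succ_self t))
    have hS := iht (s := S) hlt (h t (Nat.lt_succ_self t))
    have h0 := iht (s := 0) hlt fun s' hs' => absurd hs' (Nat.not_lt_zero s')
    induction s with
    | zero => rw [state_succ_zero, state_succ_zero, hS, h0]
    | succ s ih =>
      rw [state_succ, state_succ, ih fun s' hs' => h' s' (hs'.trans (Nat.lt_succ_self s)),
        h' s (Nat.lt_succ_self s)]

lemma state_update (hm : 0 < m) (hW : IsMixingMatrix G W) {T : ℕ}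
    (ω : Fin T × Fin S × Fin n × Fin b → Fin m) (t : Fin T) (s : Fin S) (q : Fin n × Fin b)
    (z : Fin m) :
    state ℓ W η Kin Kout S x₀ (extendSample hm (Function.update ω (t, s, q) z)) t s =
      state ℓ W η Kin Kout S x₀ (extendSample hm ω) t s := by
  refine state_congr hW (fun t' ht' s' _ => ?_) fun s' hs' => ?_
  · ext1 i; ext1 k
    simp only [extendSample, Nat.add_sub_cancel]
    split_ifs
    · rw [Function.update_of_ne]
      intro h
      have := congrArg (fun q => (q.1 : ℕ)) h
      exact ht'.ne this
    · rfl
  · ext1 i; ext1 k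
    simp only [extendSample, Nat.add_sub_cancel]
    split_ifs
    · rw [Function.update_of_ne]
      intro h
      have := congrArg (fun q => (q.2.1 : ℕ)) h
      exact hs'.ne this
    · rfl

/-- Gradient tracking: at the beginning of an inner loop the average of the estimators is the
average of the local gradients. -/
lemma avg_state_zero_snd (hn : 0 < n) (hLip : LipschitzGradient ℓ L) (hW : IsMixingMatrix G W)
    (Z : ℕ → ℕ → Fin n → Fin b → Fin m) (t : ℕ) :
    avg (state ℓ W η Kin Kout S x₀ Z t 0).2 =
      avg (distGrad ℓ (state ℓ W η Kin Kout S x₀ Z t 0).1) := by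
  induction t with
  | zero => rw [state_zero_zero hW, avg_const hn, hLip.gradient_globalObj]
  | succ t ih =>
    rw [state_succ_zero, avg_mix_pow hW, avg_sub, avg_add, ih]
    abel

lemma avg_state_sub_avg_zero (hW : IsMixingMatrix G W)
    (Z : ℕ → ℕ → Fin n → Fin b → Fin m) (t s : ℕ) :
    avg (state ℓ W η Kin Kout S x₀ Z t s).1 - avg (state ℓ W η Kin Kout S x₀ Z t 0).1 =
      -(η • ∑ r ∈ Finset.range s, avg (state ℓ W η Kin Kout S x₀ Z t r).2) := by
  induction s with
  | zero => simp
  | succ s ih =>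
    rw [state_succ, avg_innerStep_fst hW, Finset.sum_range_succ, smul_add, neg_add, ← ih]
    abel

lemma sqNorm_outer_step_le (hn : 0 < n) (hW : IsMixingMatrix G W)
    (Z : ℕ → ℕ → Fin n → Fin b → Fin m) (t : ℕ) :
    sqNorm ((state ℓ W η Kin Kout S x₀ Z (t + 1) 0).1 - (state ℓ W η Kin Kout S x₀ Z t 0).1) ≤
      S * ∑ s ∈ Finset.range S, n * η ^ 2 * ‖avg (state ℓ W η Kin Kout S x₀ Z t s).2‖ ^ 2 +
      2 * sqNorm (dev (state ℓ W η Kin Kout S x₀ Z (t + 1) 0).1) +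
      2 * sqNorm (dev (state ℓ W η Kin Kout S x₀ Z t 0).1) := by
  rw [sqNorm_eq hn, avg_sub, dev_sub, state_succ_zero, avg_state_sub_avg_zero hW, norm_neg,
    norm_smul, mul_pow, Real.norm_eq_abs, sq_abs, add_assoc]
  refine add_le_add ?_ (sqNorm_sub_le _ _)
  have h : ‖∑ s ∈ Finset.range S, avg (state ℓ W η Kin Kout S x₀ Z t s).2‖ ^ 2 ≤
      S * ∑ s ∈ Finset.range S, ‖avg (state ℓ W η Kin Kout S x₀ Z t s).2‖ ^ 2 := by
    refine (pow_le_pow_left₀ (norm_nonneg _) (norm_sum_le _ _) 2).trans ?_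
    simpa using sq_sum_le_card_mul_sum_sq (s := Finset.range S)
      (f := fun s => ‖avg (state ℓ W η Kin Kout S x₀ Z t s).2‖)
  rw [← Finset.mul_sum]
  calc _ ≤ (n : ℝ) * (η ^ 2 * (S *
        ∑ s ∈ Finset.range S, ‖avg (state ℓ W η Kin Kout S x₀ Z t s).2‖ ^ 2)) := by gcongr
    _ = _ := by ring

lemma sqNorm_dev_state_succ_zero_snd_le (hn : 0 < n) (hm : 0 < m)
    (hLip : LipschitzGradient ℓ L) (hW : IsMixingMatrix G W) (hc1 : mixingRate W ^ Kout < 1)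
    (Z : ℕ → ℕ → Fin n → Fin b → Fin m) (t : ℕ) :
    sqNorm (dev (state ℓ W η Kin Kout S x₀ Z (t + 1) 0).2) ≤
      mixingRate W ^ Kout * sqNorm (dev (state ℓ W η Kin Kout S x₀ Z t 0).2) +
      (mixingRate W ^ Kout) ^ 2 / (1 - mixingRate W ^ Kout) * L ^ 2 *
        sqNorm ((state ℓ W η Kin Kout S x₀ Z (t + 1) 0).1 -
          (state ℓ W η Kin Kout S x₀ Z t 0).1) := by
  rw [state_succ_zero, add_sub_assoc]
  refine (sqNorm_dev_mix_pow_add_le hn hW hc1 _ _).trans ?_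
  have h1 : 0 < 1 - mixingRate W ^ Kout := by linarith
  rw [mul_assoc]
  gcongr
  exact (sqNorm_dev_le hn _).trans (hLip.sqNorm_distGrad_sub_le hm _ _)

/-- Along every trajectory, consensus errors and squared step lengths are dominated by the squared
averaged estimators. -/
lemma sum_errors_le (hn : 0 < n) (hm : 0 < m) (hb : 0 < b) (hS : 0 < S) (hKin : 0 < Kin)
    (hKout : 0 < Kout) (hL : 0 < L) (hη : 0 < η) (hLip : LipschitzGradient ℓ L)
    (hW : IsMixingMatrix G W) (hstep : StepSizeCondition (mixingRate W) L η n b S Kin Kout)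
    (Z : ℕ → ℕ → Fin n → Fin b → Fin m) (T : ℕ) :
    6 * L ^ 2 / n * (∑ t ∈ Finset.range T, ∑ s ∈ Finset.range S,
        sqNorm (dev (state ℓ W η Kin Kout S x₀ Z t s).1)) +
      4 * (L ^ 2 * S / (n ^ 2 * b)) * (∑ t ∈ Finset.range T, ∑ s ∈ Finset.range S,
        sqNorm ((state ℓ W η Kin Kout S x₀ Z t (s + 1)).1 -
          (state ℓ W η Kin Kout S x₀ Z t s).1)) ≤
      2 * (1 - η * L) * ∑ t ∈ Finset.range T, ∑ s ∈ Finset.range S,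
        ‖avg (state ℓ W η Kin Kout S x₀ Z t s).2‖ ^ 2 := by
  have hn' : (0 : ℝ) < n := by positivity
  have hb' : (0 : ℝ) < b := by positivity
  have hα := mixingRate_nonneg W
  obtain ⟨ha1, hc1, h1, h2, h3, h4, h5⟩ := hstep.bounds hα hL hη hn hb hKin hKout
  have ha : 0 < 1 - mixingRate W ^ Kin := by linarith
  have hc : 0 < 1 - mixingRate W ^ Kout := by linarith
  obtain ⟨X, hX, hP, hΔ, hXle⟩ := sum_consensus_le (S := S)
    (P := fun t s => sqNorm (dev (state ℓ W η Kin Kout S x₀ Z t s).1))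
    (Q := fun t s => sqNorm (dev (state ℓ W η Kin Kout S x₀ Z t s).2))
    (w := fun t s => n * η ^ 2 * ‖avg (state ℓ W η Kin Kout S x₀ Z t s).2‖ ^ 2)
    (δ := fun t s => sqNorm ((state ℓ W η Kin Kout S x₀ Z t (s + 1)).1 -
      (state ℓ W η Kin Kout S x₀ Z t s).1))
    (D := fun t => sqNorm ((state ℓ W η Kin Kout S x₀ Z (t + 1) 0).1 -
      (state ℓ W η Kin Kout S x₀ Z t 0).1))
    (A := (mixingRate W ^ Kin) ^ 2 / (1 - mixingRate W ^ Kin) * η ^ 2)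
    (B := (mixingRate W ^ Kin) ^ 2 / (1 - mixingRate W ^ Kin) * L ^ 2)
    (C := (mixingRate W ^ Kout) ^ 2 / (1 - mixingRate W ^ Kout) * L ^ 2)
    (pow_nonneg hα Kin) ha1 hc1 (by positivity) (by positivity) (by positivity) hS
    (fun t s => sqNorm_nonneg _) (fun t s => sqNorm_nonneg _)
    (fun t s => sqNorm_dev_innerStep_fst_le hn hW ha1 _ _)
    (fun t s => sqNorm_dev_innerStep_snd_le hn hb hLip hW ha1 _ _)
    (fun t s => sqNorm_innerStep_sub_le hn hW _ _)
    (by rw [state_zero_zero hW, dev_const hn]; simp [sqNorm])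
    (fun t => rfl)
    (by rw [state_zero_zero hW, dev_const hn]; simp [sqNorm])
    (fun t => sqNorm_dev_state_succ_zero_snd_le hn hm hLip hW hc1 Z t)
    (fun t => sqNorm_outer_step_le hn hW Z t) T
  simp only [← Finset.mul_sum] at hΔ hXle
  have key := error_le_descent (θ := η * L) (N := (n : ℝ) * b) (S := S) (pow_nonneg hα Kin) ha1 hc1
    (by positivity) (by positivity) hX (by positivity) (by positivity) h1 h2 h3 h4 h5 hP hΔ
    (hXle.trans (le_of_eq (by field_simp)))
  have hpos : 0 < n * η ^ 2 := by positivity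
  refine le_of_mul_le_mul_left ?_ hpos
  refine le_trans (le_of_eq ?_) (key.trans (le_of_eq ?_))
  · field_simp
  · ring

/-- Along every trajectory, the mean squared gradient is bounded by the total decrease of the
objective, up to the error of the averaged estimators, which is compensated on average. -/
lemma sum_gradient_sq_le (hn : 0 < n) (hm : 0 < m) (hb : 0 < b) (hS : 0 < S) (hKin : 0 < Kin)
    (hKout : 0 < Kout) (hL : 0 < L) (hη : 0 < η) (hLip : LipschitzGradient ℓ L)
    (hbdd : BddBelow (Set.range (globalObj ℓ)))
    (hW : IsMixingMatrix G W) (hstep : StepSizeCondition (mixingRate W) L η n b S Kin Kout)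
    (Z : ℕ → ℕ → Fin n → Fin b → Fin m) (T : ℕ) :
    ∑ t ∈ Finset.range T, ∑ s ∈ Finset.range S,
        1 / (n : ℝ) * ∑ i, ‖gradient (globalObj ℓ) ((state ℓ W η Kin Kout S x₀ Z t s).1 i)‖ ^ 2 ≤
      4 / η * (globalObj ℓ x₀ - ⨅ x, globalObj ℓ x) +
      4 * ((∑ t ∈ Finset.range T, ∑ s ∈ Finset.range S,
        ‖avg (state ℓ W η Kin Kout S x₀ Z t s).2 -
          avg (distGrad ℓ (state ℓ W η Kin Kout S x₀ Z t s).1)‖ ^ 2) -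
      L ^ 2 * S / (n ^ 2 * b) * (∑ t ∈ Finset.range T, ∑ s ∈ Finset.range S,
        sqNorm ((state ℓ W η Kin Kout S x₀ Z t (s + 1)).1 -
          (state ℓ W η Kin Kout S x₀ Z t s).1))) := by
  have herr := sum_errors_le (x₀ := x₀) hn hm hb hS hKin hKout hL hη hLip hW hstep Z T
  have hsum := Finset.sum_le_sum fun t (_ : t ∈ Finset.range T) =>
    Finset.sum_le_sum fun s (_ : s ∈ Finset.range S) =>
      gradient_sq_le_innerStep (Kin := Kin) hn hm hη hLip hW (Z (t + 1) (s + 1))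
        (state ℓ W η Kin Kout S x₀ Z t s)
  simp only [← state_succ] at hsum
  have htel : ∑ t ∈ Finset.range T, ∑ s ∈ Finset.range S,
      (globalObj ℓ (avg (state ℓ W η Kin Kout S x₀ Z t s).1) -
        globalObj ℓ (avg (state ℓ W η Kin Kout S x₀ Z t (s + 1)).1)) ≤
      globalObj ℓ x₀ - ⨅ x, globalObj ℓ x := by
    have h1 : ∀ t, ∑ s ∈ Finset.range S,
        (globalObj ℓ (avg (state ℓ W η Kin Kout S x₀ Z t s).1) -
          globalObj ℓ (avg (state ℓ W η Kin Kout S x₀ Z t (s + 1)).1)) =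
        globalObj ℓ (avg (state ℓ W η Kin Kout S x₀ Z t 0).1) -
          globalObj ℓ (avg (state ℓ W η Kin Kout S x₀ Z (t + 1) 0).1) := fun t => by
      rw [Finset.sum_range_sub' fun s => globalObj ℓ (avg (state ℓ W η Kin Kout S x₀ Z t s).1)]
      rfl
    rw [Finset.sum_congr rfl fun t _ => h1 t, Finset.sum_range_sub' fun t =>
      globalObj ℓ (avg (state ℓ W η Kin Kout S x₀ Z t 0).1), state_zero_zero hW, avg_const hn]
    exact sub_le_sub_left (ciInf_le hbdd _) _
  have htel' := mul_le_mul_of_nonneg_left htel (show 0 ≤ 4 / η by positivity)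
  simp only [Finset.sum_add_distrib, Finset.sum_sub_distrib, ← Finset.mul_sum] at hsum htel' ⊢
  linarith

/-- The mean square of the error of the averaged estimators grows in one inner iteration at most
by the variance of the mini-batches. -/
lemma sum_estimator_error_succ_le (hn : 0 < n) (hm : 0 < m) (hb : 0 < b)
    (hLip : LipschitzGradient ℓ L) (hW : IsMixingMatrix G W) {T : ℕ} (t : Fin T) (s : Fin S) :
    ∑ ω : Fin T × Fin S × Fin n × Fin b → Fin m,
        ‖avg (state ℓ W η Kin Kout S x₀ (extendSample hm ω) t (s + 1)).2 -
          avg (distGrad ℓ (state ℓ W η Kin Kout S x₀ (extendSample hm ω) t (s + 1)).1)‖ ^ 2 ≤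
      ∑ ω : Fin T × Fin S × Fin n × Fin b → Fin m,
        (‖avg (state ℓ W η Kin Kout S x₀ (extendSample hm ω) t s).2 -
          avg (distGrad ℓ (state ℓ W η Kin Kout S x₀ (extendSample hm ω) t s).1)‖ ^ 2 +
        L ^ 2 / (n ^ 2 * b) * sqNorm ((state ℓ W η Kin Kout S x₀ (extendSample hm ω) t (s + 1)).1 -
          (state ℓ W η Kin Kout S x₀ (extendSample hm ω) t s).1)) := by
  have : Nonempty (Fin m) := ⟨⟨0, hm⟩⟩
  have he : Function.Injective (fun q : Fin n × Fin b => (t, s, q)) := fun q r h => by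
    simpa using h
  have hω : ∀ (ω : Fin T × Fin S × Fin n × Fin b → Fin m) (q : Fin n × Fin b),
      extendSample hm ω (t + 1) (s + 1) q.1 q.2 = ω (t, s, q) := fun ω q => by
    simp [extendSample]
  have h := sum_norm_add_noise_sq_le he
    (fun ω => avg (state ℓ W η Kin Kout S x₀ (extendSample hm ω) t s).2 -
      avg (distGrad ℓ (state ℓ W η Kin Kout S x₀ (extendSample hm ω) t s).1))
    (fun q ω => sampleIncrement b ℓ W η Kin (state ℓ W η Kin Kout S x₀ (extendSample hm ω) t s) q)
    (fun ω q z => by simp only [state_update hm hW])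
    (fun r ω q z => by simp only [state_update hm hW]) Finset.univ
  simp only [state_succ, avg_innerStep_snd_sub hb hLip hW, hω]
  refine h.trans (Finset.sum_le_sum fun ω _ => ?_)
  gcongr
  exact sum_sampleIncrement_le hn hm hb hLip _

lemma sum_estimator_error_le (hn : 0 < n) (hm : 0 < m) (hb : 0 < b)
    (hLip : LipschitzGradient ℓ L) (hW : IsMixingMatrix G W) {T : ℕ} (t : Fin T) {s : ℕ}
    (hs : s ≤ S) :
    ∑ ω : Fin T × Fin S × Fin n × Fin b → Fin m,
        ‖avg (state ℓ W η Kin Kout S x₀ (extendSample hm ω) t s).2 -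
          avg (distGrad ℓ (state ℓ W η Kin Kout S x₀ (extendSample hm ω) t s).1)‖ ^ 2 ≤
      ∑ ω : Fin T × Fin S × Fin n × Fin b → Fin m, L ^ 2 / (n ^ 2 * b) *
        ∑ r ∈ Finset.range s, sqNorm ((state ℓ W η Kin Kout S x₀ (extendSample hm ω) t (r + 1)).1 -
          (state ℓ W η Kin Kout S x₀ (extendSample hm ω) t r).1) := by
  induction s with
  | zero => simp [avg_state_zero_snd hn hLip hW]
  | succ s ih =>
    refine (sum_estimator_error_succ_le hn hm hb hLip hW t ⟨s, hs⟩).trans ?_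
    simp only [Finset.sum_range_succ, mul_add, Finset.sum_add_distrib]
    exact add_le_add_left (ih (Nat.le_of_succ_le hs)) _

/-- The bound of the theorem for a fixed initial parameter, with the expectation over the samples
written as a finite sum. -/
lemma sum_sum_gradient_sq_le (hn : 0 < n) (hm : 0 < m) (hb : 0 < b) (hS : 0 < S) (hKin : 0 < Kin)
    (hKout : 0 < Kout) (hL : 0 < L) (hη : 0 < η) (hLip : LipschitzGradient ℓ L)
    (hbdd : BddBelow (Set.range (globalObj ℓ)))
    (hW : IsMixingMatrix G W) (hstep : StepSizeCondition (mixingRate W) L η n b S Kin Kout)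
    (T : ℕ) :
    ∑ ω : Fin T × Fin S × Fin n × Fin b → Fin m,
      ∑ t ∈ Finset.range T, ∑ s ∈ Finset.range S, 1 / (n : ℝ) *
        ∑ i, ‖gradient (globalObj ℓ)
          ((state ℓ W η Kin Kout S x₀ (extendSample hm ω) t s).1 i)‖ ^ 2 ≤
      Fintype.card (Fin T × Fin S × Fin n × Fin b → Fin m) *
        (4 / η * (globalObj ℓ x₀ - ⨅ x, globalObj ℓ x)) := by
  have h1 := Finset.sum_le_sum fun (ω : Fin T × Fin S × Fin n × Fin b → Fin m)
      (_ : ω ∈ Finset.univ) => sum_gradient_sq_le (x₀ := x₀) hn hm hb hS hKin hKout hL hη hLip hbdd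
        hW hstep (extendSample hm ω) T
  refine h1.trans ?_
  rw [Finset.sum_add_distrib, Finset.sum_const, Finset.card_univ, nsmul_eq_mul, ← Finset.mul_sum,
    Finset.sum_sub_distrib]
  have h2 : ∑ ω : Fin T × Fin S × Fin n × Fin b → Fin m,
      ∑ t ∈ Finset.range T, ∑ s ∈ Finset.range S,
        ‖avg (state ℓ W η Kin Kout S x₀ (extendSample hm ω) t s).2 -
          avg (distGrad ℓ (state ℓ W η Kin Kout S x₀ (extendSample hm ω) t s).1)‖ ^ 2 ≤
      ∑ ω : Fin T × Fin S × Fin n × Fin b → Fin m, L ^ 2 * S / (n ^ 2 * b) *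
        ∑ t ∈ Finset.range T, ∑ s ∈ Finset.range S,
          sqNorm ((state ℓ W η Kin Kout S x₀ (extendSample hm ω) t (s + 1)).1 -
            (state ℓ W η Kin Kout S x₀ (extendSample hm ω) t s).1) := by
    simp only [Finset.mul_sum (Finset.range T)]
    rw [Finset.sum_comm, Finset.sum_comm (s := Finset.univ)]
    refine Finset.sum_le_sum fun t ht => ?_
    rw [Finset.sum_comm]
    have h3 : ∀ s ∈ Finset.range S, ∑ ω : Fin T × Fin S × Fin n × Fin b → Fin m,
        ‖avg (state ℓ W η Kin Kout S x₀ (extendSample hm ω) t s).2 -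
          avg (distGrad ℓ (state ℓ W η Kin Kout S x₀ (extendSample hm ω) t s).1)‖ ^ 2 ≤
        ∑ ω : Fin T × Fin S × Fin n × Fin b → Fin m, L ^ 2 / (n ^ 2 * b) *
          ∑ r ∈ Finset.range S,
            sqNorm ((state ℓ W η Kin Kout S x₀ (extendSample hm ω) t (r + 1)).1 -
              (state ℓ W η Kin Kout S x₀ (extendSample hm ω) t r).1) := fun s hs => by
      have hs' := (Finset.mem_range.1 hs).le
      refine (sum_estimator_error_le hn hm hb hLip hW ⟨t, Finset.mem_range.1 ht⟩ hs').trans ?_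
      refine Finset.sum_le_sum fun ω _ => mul_le_mul_of_nonneg_left ?_ (by positivity)
      exact Finset.sum_le_sum_of_subset_of_nonneg (Finset.range_subset_range.2 hs')
        fun _ _ _ => sqNorm_nonneg _
    refine (Finset.sum_le_sum h3).trans (le_of_eq ?_)
    rw [Finset.sum_const, Finset.card_range, nsmul_eq_mul, Finset.mul_sum]
    refine Finset.sum_congr rfl fun ω _ => ?_
    ring
  linarith

end Trajectory

end Destress

end

namespace Destress

/-! ### Continuity in the initial parameter -/

section Continuity

variable {n m d b Kin Kout S : ℕ} {ℓ : Fin n → Fin m → Param d → ℝ} {L η : ℝ}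
  {W : Matrix (Fin n) (Fin n) ℝ}

lemma continuous_mix (W : Matrix (Fin n) (Fin n) ℝ) :
    Continuous (mix W : Stack n d → Stack n d) := by
  unfold mix
  fun_prop

lemma LipschitzGradient.continuous_distGrad (hLip : LipschitzGradient ℓ L) (hm : 0 < m) :
    Continuous (distGrad ℓ) :=
  continuous_pi fun i => (hLip.continuous_gradient_localObj hm i).comp (continuous_apply i)

lemma continuous_innerStep (hLip : LipschitzGradient ℓ L) (Z : Fin n → Fin b → Fin m) :
    Continuous (innerStep ℓ W η Kin Z) := by
  have hu : Continuous fun p : Stack n d × Stack n d => mix (W ^ Kin) (p.1 - η • p.2) :=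
    (continuous_mix _).comp (by fun_prop)
  refine hu.prodMk ((continuous_mix _).comp (continuous_pi fun i => ?_))
  have hv : Continuous fun p : Stack n d × Stack n d => p.2 i := by fun_prop
  refine ((continuous_finsetSum _ fun k _ => ?_).const_smul (1 / (b : ℝ))).add hv
  exact ((hLip.continuous_gradient _ _).comp ((continuous_apply i).comp hu)).sub
    ((hLip.continuous_gradient _ _).comp ((continuous_apply i).comp continuous_fst))

lemma continuous_state {G : SimpleGraph (Fin n)} (hn : 0 < n) (hm : 0 < m)
    (hLip : LipschitzGradient ℓ L) (hW : IsMixingMatrix G W)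
    (Z : ℕ → ℕ → Fin n → Fin b → Fin m) (t s : ℕ) :
    Continuous fun x₀ : Param d => state ℓ W η Kin Kout S x₀ Z t s := by
  have hstep : ∀ t, (Continuous fun x₀ : Param d => state ℓ W η Kin Kout S x₀ Z t 0) →
      ∀ s, Continuous fun x₀ : Param d => state ℓ W η Kin Kout S x₀ Z t s := fun t h0 s => by
    induction s with
    | zero => exact h0
    | succ s ih => exact (continuous_innerStep hLip _).comp ih
  refine hstep t ?_ s
  induction t with
  | zero =>
    simp only [state_zero_zero hW]
    exact (continuous_pi fun _ => continuous_id).prodMk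
      (continuous_pi fun _ => hLip.continuous_gradient_globalObj hn hm)
  | succ t ih =>
    simp only [state_succ_zero]
    have hS := (hstep t ih S).fst
    exact hS.prodMk ((continuous_mix _).comp ((ih.snd.add
      ((hLip.continuous_distGrad hm).comp hS)).sub ((hLip.continuous_distGrad hm).comp ih.fst)))

end Continuity

/-! ### From finite averages to expectations -/

section Expectation

variable {Ω : Type*} [MeasurableSpace Ω] {μ : Measure Ω}

/-- The expectation of a function of a random variable `X` and an independent variable `Y` with
finitely many values. -/
lemma integral_indep_finite [IsProbabilityMeasure μ] {E κ : Type*} [MeasurableSpace E]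
    [MeasurableSpace κ] [Fintype κ] [MeasurableSingletonClass κ] {X : Ω → E} {Y : Ω → κ}
    (hX : Measurable X) (hY : Measurable Y) (hXY : IndepFun X Y μ) {g : κ → E → ℝ}
    (hg : ∀ k, Measurable (g k)) (hint : ∀ k, Integrable (fun ω => g k (X ω)) μ) :
    Integrable (fun ω => g (Y ω) (X ω)) μ ∧
      ∫ ω, g (Y ω) (X ω) ∂μ = ∑ k, μ.real (Y ⁻¹' {k}) * ∫ ω, g k (X ω) ∂μ := by
  classical
  have hmeas : ∀ k, Measurable (Set.indicator ({k} : Set κ) (fun _ => (1 : ℝ))) := fun k =>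
    measurable_const.indicator (measurableSet_singleton k)
  have h1 : (fun ω => g (Y ω) (X ω)) =
      fun ω => ∑ k, Set.indicator ({k} : Set κ) (fun _ => (1 : ℝ)) (Y ω) * g k (X ω) := by
    ext ω
    rw [Finset.sum_eq_single (Y ω)]
    · simp
    · intro k _ hk
      simp [Set.indicator_of_notMem, hk.symm]
    · simp
  have h2 : ∀ k, Integrable
      (fun ω => Set.indicator ({k} : Set κ) (fun _ => (1 : ℝ)) (Y ω) * g k (X ω)) μ := fun k => by
    have h := (hint k).indicator (hY (measurableSet_singleton k))
    refine h.congr (Filter.Eventually.of_forall fun ω => ?_)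
    by_cases hk : Y ω = k <;> simp [Set.indicator, hk]
  rw [h1]
  refine ⟨integrable_finsetSum _ fun k _ => h2 k, ?_⟩
  rw [integral_finsetSum _ fun k _ => h2 k]
  refine Finset.sum_congr rfl fun k _ => ?_
  refine ((hXY.symm.comp (hmeas k) (hg k)).integral_fun_mul_eq_mul_integral
    ((hmeas k).comp hY).aestronglyMeasurable ((hg k).comp hX).aestronglyMeasurable).trans ?_
  congr 1
  have h3 : (fun ω => Set.indicator ({k} : Set κ) (fun _ => (1 : ℝ)) (Y ω)) =
      Set.indicator (Y ⁻¹' {k}) (1 : Ω → ℝ) := by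
    ext ω
    by_cases hk : Y ω = k <;> simp [Set.indicator, hk]
  rw [← integral_indicator_one (hY (measurableSet_singleton k)), ← h3]
  rfl

lemma real_preimage_singleton_of_uniform {κ : Type*} [MeasurableSpace κ] [Fintype κ]
    [MeasurableSingletonClass κ] {Y : Ω → κ} (hY : Measurable Y)
    (hlaw : μ.map Y = uniformOn Set.univ) (k : κ) :
    μ.real (Y ⁻¹' {k}) = 1 / Fintype.card κ := by
  rw [measureReal_def, ← Measure.map_apply hY (measurableSet_singleton k), hlaw, uniformOn_univ]
  simp

lemma real_preimage_singleton_of_iIndep_uniform [IsProbabilityMeasure μ] {ι κ : Type*}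
    [Fintype ι] [MeasurableSpace κ] [DecidableEq ι] [Fintype κ] [MeasurableSingletonClass κ]
    {Y : ι → Ω → κ} (hY : ∀ q, Measurable (Y q)) (hind : iIndepFun Y μ)
    (hlaw : ∀ q, μ.map (Y q) = uniformOn Set.univ) (z : ι → κ) :
    μ.real ((fun ω q => Y q ω) ⁻¹' {z}) = 1 / Fintype.card (ι → κ) := by
  have h1 : (fun ω q => Y q ω) ⁻¹' {z} = ⋂ q ∈ Finset.univ, Y q ⁻¹' {z q} := by
    ext ω; simp [funext_iff]
  rw [measureReal_def, h1, hind.measure_inter_preimage_eq_mul Finset.univ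
    (sets := fun q => {z q}) fun q _ => measurableSet_singleton (z q), ENNReal.toReal_prod]
  have h2 : ∀ q, (μ (Y q ⁻¹' {z q})).toReal = 1 / (Fintype.card κ : ℝ) := fun q =>
    real_preimage_singleton_of_uniform (hY q) (hlaw q) (z q)
  simp [h2]

end Expectation

/-- The output in terms of the finitely many samples that are used. -/
lemma output_eq_state {n m d b T S Kin Kout : ℕ} {ℓ : Fin n → Fin m → Param d → ℝ} {η : ℝ}
    {G : SimpleGraph (Fin n)} {W : Matrix (Fin n) (Fin n) ℝ} (hm : 0 < m)
    (hW : IsMixingMatrix G W) (x₀ : Param d) (Z : ℕ → ℕ → Fin n → Fin b → Fin m)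
    (J : Fin n × Fin T × Fin S) :
    output ℓ W η Kin Kout x₀ Z J =
      (state ℓ W η Kin Kout S x₀ (extendSample (T := T) (S := S) hm
        fun q => Z (q.1 + 1) (q.2.1 + 1) q.2.2.1 q.2.2.2) J.2.1 J.2.2).1 J.1 := by
  have h : state ℓ W η Kin Kout S x₀ Z J.2.1 J.2.2 = state ℓ W η Kin Kout S x₀
      (extendSample (T := T) (S := S) hm
        fun q => Z (q.1 + 1) (q.2.1 + 1) q.2.2.1 q.2.2.2) J.2.1 J.2.2 := by
    refine state_congr hW (fun t ht s hs => ?_) fun s hs => ?_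
    · ext1 i; ext1 k
      simp [extendSample, ht.trans J.2.1.isLt, hs]
    · ext1 i; ext1 k
      simp [extendSample, hs.trans J.2.2.isLt]
  rw [← h]
  rfl

end Destress

theorem theorem1 {n m d b T S Kin Kout : ℕ}
    (hn : 0 < n) (hm : 0 < m) (hb : 0 < b) (hT : 0 < T) (hS : 0 < S)
    (hKin : 0 < Kin) (hKout : 0 < Kout)
    (ℓ : Fin n → Fin m → Destress.Param d → ℝ) {L η : ℝ} (hL : 0 < L) (hη : 0 < η)
    (hLip : Destress.LipschitzGradient ℓ L)
    (hbdd : BddBelow (Set.range (Destress.globalObj ℓ)))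
    (G : SimpleGraph (Fin n)) (W : Matrix (Fin n) (Fin n) ℝ) (hW : Destress.IsMixingMatrix G W)
    (hstep : Destress.StepSizeCondition (Destress.mixingRate W) L η n b S Kin Kout)
    {Ω : Type*} [MeasurableSpace Ω] (μ : Measure Ω) [IsProbabilityMeasure μ]
    (x₀ : Ω → Destress.Param d) (Z : ℕ → ℕ → Fin n → Fin b → Ω → Fin m)
    (J : Ω → Fin n × Fin T × Fin S) (hrand : Destress.IsRandomness μ x₀ Z J)
    (hinit : Integrable (fun ω => Destress.globalObj ℓ (x₀ ω)) μ) :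
    Integrable (fun ω => ‖gradient (Destress.globalObj ℓ) (Destress.output ℓ W η Kin Kout (x₀ ω)
        (fun t s i k => Z t s i k ω) (J ω))‖ ^ 2) μ ∧
      ∫ ω, ‖gradient (Destress.globalObj ℓ) (Destress.output ℓ W η Kin Kout (x₀ ω)
          (fun t s i k => Z t s i k ω) (J ω))‖ ^ 2 ∂μ ≤
        4 / (η * (T : ℝ) * (S : ℝ)) *
          ((∫ ω, Destress.globalObj ℓ (x₀ ω) ∂μ) - ⨅ x, Destress.globalObj ℓ x) := by
  open Destress in
  have hn' : (0 : ℝ) < n := by positivity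
  have hT' : (0 : ℝ) < T := by positivity
  have hS' : (0 : ℝ) < S := by positivity
  set N : ℝ := (Fintype.card (Fin T × Fin S × Fin n × Fin b → Fin m) : ℝ) with hN_def
  have hN : 0 < N := by rw [hN_def]; simp only [Fintype.card_fun, Fintype.card_fin]; positivity
  -- The squared gradient at the output, for given samples, output index and initial parameter.
  set g : (Fin T × Fin S × Fin n × Fin b → Fin m) → (Fin n × Fin T × Fin S) → Param d → ℝ :=
    fun z j x => ‖gradient (globalObj ℓ)
      ((state ℓ W η Kin Kout S x (extendSample hm z) j.2.1 j.2.2).1 j.1)‖ ^ 2 with hg_def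
  have hg0 : ∀ z j x, 0 ≤ g z j x := fun z j x => sq_nonneg _
  have hgm : ∀ z j, Measurable (g z j) := fun z j =>
    (((hLip.continuous_gradient_globalObj hn hm).comp ((continuous_apply j.1).comp
      (continuous_state hn hm hLip hW _ _ _).fst)).norm.pow 2).measurable
  have hsum : ∀ x, ∑ j, ∑ z, g z j x ≤ n * (N * (4 / η * (globalObj ℓ x - ⨅ x, globalObj ℓ x))) :=
    fun x => by
      have h := mul_le_mul_of_nonneg_left (sum_sum_gradient_sq_le (x₀ := x) (b := b) hn hm hb hS hKin
        hKout hL hη hLip hbdd hW hstep T) hn'.le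
      refine le_trans (le_of_eq ?_) h
      rw [Finset.sum_comm, Finset.mul_sum]
      refine Finset.sum_congr rfl fun z _ => ?_
      simp only [hg_def, Fintype.sum_prod_type, ← Finset.mul_sum]
      rw [← mul_assoc, mul_one_div_cancel hn'.ne', one_mul, Finset.sum_comm, Finset.sum_range]
      refine Finset.sum_congr rfl fun t _ => ?_
      rw [Finset.sum_comm, Finset.sum_range]
  have hdom : Integrable
      (fun ω => n * (N * (4 / η * (globalObj ℓ (x₀ ω) - ⨅ x, globalObj ℓ x)))) μ :=
    (((hinit.sub (integrable_const _)).const_mul _).const_mul _).const_mul _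
  have hgint : ∀ z j, Integrable (fun ω => g z j (x₀ ω)) μ := fun z j => by
    refine hdom.mono' ((hgm z j).comp hrand.measurable_init).aestronglyMeasurable
      (Filter.Eventually.of_forall fun ω => ?_)
    rw [Real.norm_of_nonneg (hg0 _ _ _)]
    refine le_trans ?_ (hsum (x₀ ω))
    exact (Finset.single_le_sum (f := fun z => g z j (x₀ ω)) (fun z _ => hg0 _ _ _)
      (Finset.mem_univ z)).trans (Finset.single_le_sum (f := fun j => ∑ z, g z j (x₀ ω))
        (fun j _ => Finset.sum_nonneg fun z _ => hg0 _ _ _) (Finset.mem_univ j))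
  set ζ : Ω → Fin T × Fin S × Fin n × Fin b → Fin m := fun ω q => usedSample T S Z q ω with hζ
  have hζm : Measurable ζ := measurable_pi_lambda _ hrand.measurable_sample
  -- Average first over the samples, then over the output index.
  have hstep1 := fun j => integral_indep_finite hrand.measurable_init hζm hrand.indep_init
    (g := fun z x => g z j x) (fun z => hgm z j) fun z => hgint z j
  have hgm2 : ∀ j, Measurable fun p : Param d × (Fin T × Fin S × Fin n × Fin b → Fin m) =>
      g p.2 j p.1 := fun j => measurable_from_prod_countable_left fun z => hgm z j
  have hstep2 := integral_indep_finite (hrand.measurable_init.prodMk hζm) hrand.measurable_index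
    hrand.indep_index.symm (g := fun j p => g p.2 j p.1) hgm2 fun j => (hstep1 j).1
  have hout : (fun ω => ‖gradient (globalObj ℓ) (output ℓ W η Kin Kout (x₀ ω)
      (fun t s i k => Z t s i k ω) (J ω))‖ ^ 2) = fun ω => g (ζ ω) (J ω) (x₀ ω) := by
    ext ω
    rw [output_eq_state hm hW]
    rfl
  rw [hout]
  refine ⟨hstep2.1, ?_⟩
  have hJ := real_preimage_singleton_of_uniform hrand.measurable_index hrand.index_law
  have hζlaw := real_preimage_singleton_of_iIndep_uniform hrand.measurable_sample
    hrand.indep_sample hrand.sample_law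
  calc ∫ ω, g (ζ ω) (J ω) (x₀ ω) ∂μ
      = ∑ j, 1 / (n * (T * S) : ℝ) * ∑ z, 1 / N * ∫ ω, g z j (x₀ ω) ∂μ := by
        refine hstep2.2.trans (Finset.sum_congr rfl fun j _ => ?_)
        rw [(hstep1 j).2, hJ]
        congr 1
        · simp
        · exact Finset.sum_congr rfl fun z _ => by rw [hζlaw]
    _ = 1 / (n * (T * S) : ℝ) * (1 / N) * ∫ ω, ∑ j, ∑ z, g z j (x₀ ω) ∂μ := by
        rw [integral_finsetSum _ fun j _ => integrable_finsetSum _ fun z _ => hgint z j,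
          Finset.mul_sum]
        refine Finset.sum_congr rfl fun j _ => ?_
        rw [integral_finsetSum _ fun z _ => hgint z j, ← Finset.mul_sum, mul_assoc]
    _ ≤ 1 / (n * (T * S) : ℝ) * (1 / N) *
          ∫ ω, n * (N * (4 / η * (globalObj ℓ (x₀ ω) - ⨅ x, globalObj ℓ x))) ∂μ := by
        refine mul_le_mul_of_nonneg_left ?_ (by positivity)
        exact integral_mono (integrable_finsetSum _ fun j _ => integrable_finsetSum _
          fun z _ => hgint z j) hdom fun ω => hsum (x₀ ω)
    _ = _ := by
        rw [integral_const_mul, integral_const_mul, integral_const_mul,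
          integral_sub hinit (integrable_const _), integral_const]
        simp only [probReal_univ, one_smul]
        field_simp
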